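/- Let $g\ge 0$ be a measurable function on $\mathbb R$ such that $\nu(dv)=g(v)\,dv$ is a probability measure and $$\int_{\mathbb R} g(v)\,v^2\,dv=1,\qquad \int_{\mathbb R} g(v)\,v^4\,dv<+\infty,\qquad g\in L^p(\mathbb R)\ \text{ for some } p>1 .$$ For $N\ge 1$ let $\sigma^N$ be the uniform probability measure on the sphere $S^{N-1}(\sqrt N)\subset\mathbb R^N$ of radius $\sqrt N$, and let $$\nu^{(N)}=[\nu^{\otimes N}]_{S^{N-1}(\sqrt N)}:=\frac{\prod_{j=1}^N g(v_j)}{Z_N(g,\sqrt N)}\,\sigma^N,\qquad Z_N(g,\sqrt N)=\int_{S^{N-1}(\sqrt N)}\prod_{j=1}^N g(v_j)\,d\sigma^N(v),$$ be the conditioned tensor product of $\nu$ (it is well defined for all sufficiently large $N$). For each $N\ge1$ let $\mu^{(N)}$ be a Borel probability measure on $S^{N-1}(\sqrt N)$ that is symmetric, i.e. invariant under permutations of the coordinates $v_1,\dots,v_N$. Write $H(\mu|\nu)=\int h\log h\,d\nu$ with $h=d\mu/d\nu$ if $\mu\ll\nu$, and $H(\mu|\nu)=+\infty$ otherwise. Suppose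 that $$\frac{H(\mu^{(N)}\,|\,\nu^{(N)})}{N}\longrightarrow 0\qquad (N\to\infty).$$ Then $(\mu^{(N)})$ is $\nu$-chaotic: each $\mu^{(N)}$ is symmetric and, for every integer $k\ge 1$, the marginal $P_k\mu^{(N)}$ (the law of $(v_1,\dots,v_k)$ under $\mu^{(N)}$, defined for $N\ge k$) converges weakly, i.e. against bounded continuous test functions on $\mathbb R^k$, to $\nu^{\otimes k}$ as $N\to\infty$. -/

import Mathlib

open MeasureTheory Filter Topology

namespace KacChaos

noncomputable section

/-- The sphere `S^{N-1}(√N)` of radius `√N` in `ℝ^N`. -/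
abbrev KacSphere (N : ℕ) : Type :=
  Metric.sphere (0 : EuclideanSpace ℝ (Fin N)) (Real.sqrt N)

/-- The dilation by `√N` from the unit sphere onto `S^{N-1}(√N)`. -/
def dilate (N : ℕ) (x : Metric.sphere (0 : EuclideanSpace ℝ (Fin N)) 1) : KacSphere N :=
  ⟨Real.sqrt N • (x : EuclideanSpace ℝ (Fin N)), by
    have hx : ‖(x : EuclideanSpace ℝ (Fin N))‖ = 1 := by simp
    rw [mem_sphere_zero_iff_norm, norm_smul, hx, mul_one, Real.norm_of_nonneg (Real.sqrt_nonneg _)]⟩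

/-- The uniform probability measure `σ^N` on `S^{N-1}(√N)` (for `N ≥ 1`): the surface measure
of the unit sphere, normalised to total mass one and transported by the dilation. -/
def uniformSphere (N : ℕ) : Measure (KacSphere N) :=
  ((volume : Measure (EuclideanSpace ℝ (Fin N))).toSphere Set.univ)⁻¹ •
    ((volume : Measure (EuclideanSpace ℝ (Fin N))).toSphere.map (dilate N))

/-- The normalisation `Z_N(f, √N) = ∫ ∏_j f(v_j) dσ^N(v)`, as an extended nonnegative number. -/
def partitionFn (f : ℝ → ℝ) (N : ℕ) : ENNReal :=
  ∫⁻ v : KacSphere N, ∏ j, ENNReal.ofReal (f (v.1 j)) ∂(uniformSphere N)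

/-- The conditioned tensor product `[(f dv)^{⊗N}]` on `S^{N-1}(√N)`: the measure with density
`∏_j f(v_j) / Z_N(f, √N)` with respect to `σ^N`. -/
def condTensor (f : ℝ → ℝ) (N : ℕ) : Measure (KacSphere N) :=
  (uniformSphere N).withDensity
    (fun v => (∏ j, ENNReal.ofReal (f (v.1 j))) / partitionFn f N)

/-- Permutation of the coordinates of a point of the sphere. -/
def permute {N : ℕ} (τ : Equiv.Perm (Fin N)) (v : KacSphere N) : KacSphere N :=
  ⟨WithLp.toLp 2 (fun i => v.1 (τ i)), by
    refine mem_sphere_zero_iff_norm.2 (Eq.trans ?_ (mem_sphere_zero_iff_norm.1 v.2))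
    rw [EuclideanSpace.norm_eq, EuclideanSpace.norm_eq]
    congr 1
    exact Equiv.sum_comp τ (fun i => ‖v.1 i‖ ^ 2)⟩

/-- A measure on the sphere is symmetric if it is invariant under all permutations of the
coordinates. -/
def IsSymmetric {N : ℕ} (μ : Measure (KacSphere N)) : Prop :=
  ∀ τ : Equiv.Perm (Fin N), μ.map (permute τ) = μ

/-- The first `k` coordinates `(v_1, …, v_k)` of a point of the sphere in `ℝ^N`. In the irrelevant
case `k > N` the missing coordinates are set to `0`. -/
def firstCoords (k N : ℕ) (v : KacSphere N) : Fin k → ℝ :=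
  fun i => if h : (i : ℕ) < N then v.1 ⟨i, h⟩ else 0

theorem measurable_firstCoords (k N : ℕ) : Measurable (firstCoords k N) := by
  refine measurable_pi_lambda _ fun i => ?_
  unfold firstCoords
  split_ifs <;> fun_prop

/-- The marginal `P_k μ` of a probability measure on the sphere: the law of the first `k`
coordinates. -/
def marginal (k : ℕ) {N : ℕ} (μ : ProbabilityMeasure (KacSphere N)) :
    ProbabilityMeasure (Fin k → ℝ) :=
  μ.map (measurable_firstCoords k N).aemeasurable

/-- The `k`-fold tensor product `ν^{⊗k}`, a probability measure on `ℝ^k`. -/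
def tensorPower (ν : ProbabilityMeasure ℝ) (k : ℕ) : ProbabilityMeasure (Fin k → ℝ) :=
  ProbabilityMeasure.pi fun _ => ν

/-- A sequence of probability measures `μ^{(N)}` on `S^{N-1}(√N)` is `ν`-chaotic if each
`μ^{(N)}` is symmetric and, for each positive integer `k`, the marginals `P_k μ^{(N)}` converge
to `ν^{⊗k}` weakly, i.e. against bounded continuous functions (this is the topology of
`ProbabilityMeasure`). -/
structure IsChaotic (ν : ProbabilityMeasure ℝ) (μ : ∀ N : ℕ, ProbabilityMeasure (KacSphere N)) :
    Prop where
  symmetric : ∀ N, 1 ≤ N → IsSymmetric (μ N : Measure (KacSphere N))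
  tendsto_marginal : ∀ k, 1 ≤ k →
    Tendsto (fun N => marginal k (μ N)) atTop (𝓝 (tensorPower ν k))

end

end KacChaos

open MeasureTheory Filter Topology ProbabilityTheory
open scoped ENNReal

namespace KacChaos

/-! The heart of the proof is a comparison (`exists_eventually_lintegral_exp_condTensor_le`). There
is a fixed `d` such that, for every `ε > 0` and all large `N`, a nonnegative function of the first
`N` of `N + d + 2` coordinates has integral under the conditioned tensor product at most `exp (ε N)`
times its integral under `ν^{⊗N}`.

Given this, apply the Donsker–Varadhan inequality to `t` times the centred sum of a bounded `φ` over
`L ≈ N / k` disjoint blocks of coordinates. By symmetry the left side is `t L (∫ φ dP_k μ - ∫ φ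
dν^{⊗k})`. The right side is the entropy, which is `o(N)`, plus `ε N`, plus Hoeffding's bound `L B²
t² / 2` for independent blocks. Dividing by `t L` and taking `t`, then `ε`, small bounds the
marginal integral from above; applying this to `-φ` as well gives convergence.

For the comparison, the numerator and the partition function are both computed in graph coordinates
over a hyperplane, with the same constant `sheetConst`, which cancels and is never evaluated. The
numerator (`lintegral_uniformSphere_prod_mul_le`) carries the singular weight `1 / √(R - |w|²)`.
Among `d + 2` spare coordinates the two smallest values of the density are absorbed into powers `1 +
2 / d` of the others; this frees two coordinates, one to parametrise the graph and one to integrate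
the weight away. Integrability of `g ^ (1 + 2 / d)` for large `d` is where `g ∈ L^p` enters.

The partition function is `sheetConst` times twice the density, at its mean, of a sum of independent
copies of `v²`. A local limit theorem is not needed, only that this is not exponentially small
(`eventually_exp_le_sumDensity`). A small fraction of the summands gives a density bounded below on
an interval of length linear in `n`, at an arbitrarily small exponential cost, and by Chebyshev the
other summands keep the total inside it with probability at least one half. -/

/-! ### The uniform measure of the sphere in graph coordinates. -/

theorem lintegral_eq_setLIntegral_Ioi_add_neg (f : ℝ → ℝ≥0∞) :
    ∫⁻ z, f z = (∫⁻ z in Set.Ioi 0, f z) + ∫⁻ z in Set.Ioi 0, f (-z) := by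
  have h1 : ∫⁻ z in Set.Ioi 0, f (-z) = ∫⁻ z in Set.Iio 0, f z := by
    have := (Measure.measurePreserving_neg (volume : Measure ℝ)).setLIntegral_comp_preimage_emb
      (MeasurableEquiv.neg ℝ).measurableEmbedding f (Set.Iio 0)
    simpa using this
  rw [h1, ← setLIntegral_congr (Iio_ae_eq_Iic (a := (0 : ℝ))).symm, add_comm,
    ← lintegral_add_compl f (measurableSet_Iic (a := (0 : ℝ))), Set.compl_Iic]

/-- With `s` the squared norm of the other coordinates, this trades one coordinate `z` for the
radius `r = √(s + z²)`. -/
theorem setLIntegral_Ioi_comp_sqrt_sq_add {s : ℝ} (hs : 0 ≤ s) (f : ℝ → ℝ≥0∞) :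
    ∫⁻ z in Set.Ioi 0, f z =
      ∫⁻ r in Set.Ioi (√s), ENNReal.ofReal (r * (√(r ^ 2 - s))⁻¹) * f (√(r ^ 2 - s)) := by
  have hpos : ∀ r ∈ Set.Ioi (√s), 0 < r ∧ 0 < r ^ 2 - s := by
    intro r hr
    have h0 := Real.sqrt_nonneg s
    have hr' : √s < r := hr
    have := Real.sq_sqrt hs
    exact ⟨by linarith, by nlinarith⟩
  have himg : (fun r => √(r ^ 2 - s)) '' Set.Ioi (√s) = Set.Ioi 0 := by
    ext z
    constructor
    · rintro ⟨r, hr, rfl⟩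
      exact Real.sqrt_pos.2 (hpos r hr).2
    · intro hz
      have hz' : 0 < z := hz
      refine ⟨√(z ^ 2 + s), ?_, ?_⟩
      · exact Real.sqrt_lt_sqrt hs (by nlinarith)
      · simp only
        rw [Real.sq_sqrt (by positivity), add_sub_cancel_right, Real.sqrt_sq hz'.le]
  rw [← himg, lintegral_image_eq_lintegral_abs_deriv_mul (f' := fun r => r * (√(r ^ 2 - s))⁻¹)
    measurableSet_Ioi]
  · refine setLIntegral_congr_fun measurableSet_Ioi fun r hr => ?_
    have := (hpos r hr).1
    rw [abs_of_nonneg (by positivity)]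
  · intro r hr
    have h2 := (hpos r hr).2
    have h3 : HasDerivAt (fun r : ℝ => √(r ^ 2 - s)) (2 * r / (2 * √(r ^ 2 - s))) r := by
      have : HasDerivAt (fun r : ℝ => r ^ 2 - s) (2 * r) r := by
        simpa using (hasDerivAt_pow 2 r).sub_const s
      exact this.sqrt h2.ne'
    rw [mul_div_mul_left _ _ two_ne_zero, div_eq_mul_inv] at h3
    exact h3.hasDerivWithinAt
  · intro r hr r' hr' h
    have h1 := hpos r hr
    have h2 := hpos r' hr'
    simp only at h
    rw [Real.sqrt_inj h1.2.le h2.2.le] at h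
    have : r ^ 2 = r' ^ 2 := by linarith
    exact (sq_eq_sq₀ h1.1.le h2.1.le).1 this

theorem lintegral_comp_smul_pi (n : ℕ) {a : ℝ} (ha : 0 < a) {f : (Fin n → ℝ) → ℝ≥0∞}
    (hf : Measurable f) :
    ∫⁻ w, f (a • w) = ENNReal.ofReal ((a ^ n)⁻¹) * ∫⁻ w, f w := by
  have h := Measure.map_addHaar_smul (volume : Measure (Fin n → ℝ)) ha.ne'
  rw [← lintegral_map hf (by fun_prop), h, lintegral_smul_measure, Module.finrank_fin_fun,
    abs_of_pos (by positivity), smul_eq_mul]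

/-- Polar coordinates: the integrand depends only on the direction, so the radial factor is the
integral of `r ^ (dim - 1)` over `(0, 1)`. -/
theorem lintegral_comp_normalize_mul_indicator_ball {E : Type*} [NormedAddCommGroup E]
    [NormedSpace ℝ E] [FiniteDimensional ℝ E] [Nontrivial E] [MeasurableSpace E] [BorelSpace E]
    (μ : Measure E) [μ.IsAddHaarMeasure] {H : E → ℝ≥0∞} (hH : Measurable H) :
    ∫⁻ x, H (‖x‖⁻¹ • x) * (Set.Iio (1 : ℝ)).indicator 1 ‖x‖ ∂μ =
      (∫⁻ ω, H ω ∂μ.toSphere) *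
        ENNReal.ofReal (1 / ((Module.finrank ℝ E - 1 : ℕ) + 1)) := by
  have h0 : μ.restrict {0}ᶜ = μ := restrict_compl_singleton 0
  set Ψ : Metric.sphere (0 : E) 1 × Set.Ioi (0 : ℝ) → ℝ≥0∞ :=
    fun y => H y.1 * (Set.Iio (⟨1, Set.mem_Ioi.2 one_pos⟩ : Set.Ioi (0 : ℝ))).indicator 1 y.2
    with hΨ
  have hi : Measurable ((Set.Iio (⟨1, Set.mem_Ioi.2 one_pos⟩ : Set.Ioi (0 : ℝ))).indicator
      (1 : Set.Ioi (0 : ℝ) → ℝ≥0∞)) := measurable_one.indicator measurableSet_Iio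
  have hΨm : Measurable Ψ :=
    (hH.comp (measurable_subtype_coe.comp measurable_fst)).mul (hi.comp measurable_snd)
  calc _ = ∫⁻ x in ({0}ᶜ : Set E), H (‖x‖⁻¹ • x) * (Set.Iio (1 : ℝ)).indicator 1 ‖x‖ ∂μ := by
          rw [h0]
    _ = ∫⁻ x : ({0}ᶜ : Set E), H (‖(x : E)‖⁻¹ • (x : E)) *
          (Set.Iio (1 : ℝ)).indicator 1 ‖(x : E)‖ ∂μ.comap Subtype.val :=
        (lintegral_subtype_comap (measurableSet_singleton 0).compl
          (fun x : E => H (‖x‖⁻¹ • x) * (Set.Iio (1 : ℝ)).indicator 1 ‖x‖)).symm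
    _ = ∫⁻ x : ({0}ᶜ : Set E), Ψ (homeomorphUnitSphereProd E x) ∂μ.comap Subtype.val := by
        refine lintegral_congr fun x => ?_
        simp only [hΨ, homeomorphUnitSphereProd_apply_fst_coe]
        congr 1
        simp [Set.indicator_apply, ← Subtype.coe_lt_coe]
    _ = _ := by
      rw [μ.measurePreserving_homeomorphUnitSphereProd.lintegral_comp hΨm, hΨ,
        lintegral_prod_mul (f := fun ω : Metric.sphere (0 : E) 1 => H ω) (by fun_prop)
          hi.aemeasurable,
        lintegral_indicator_one measurableSet_Iio, Measure.volumeIoiPow_apply_Iio, one_pow]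

theorem measurable_dilate (N : ℕ) : Measurable (dilate N) := by
  unfold dilate
  exact Measurable.subtype_mk (by fun_prop)

/-- The uniform measure is, up to a factor, the radial projection of Lebesgue measure on the unit
ball. This reduces surface integrals to Lebesgue integrals, where one coordinate can be singled out
by Tonelli. -/
theorem exists_lintegral_uniformSphere_eq (n : ℕ) :
    ∃ c : ℝ≥0∞, c ≠ 0 ∧ c ≠ ∞ ∧ ∀ F : (Fin (n + 1) → ℝ) → ℝ≥0∞, Measurable F →
      ∫⁻ v : KacSphere (n + 1), F v.1 ∂uniformSphere (n + 1) =
        c * ∫⁻ x : Fin (n + 1) → ℝ, F ((√(n + 1 : ℕ) / √(∑ i, x i ^ 2)) • x) *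
          (Set.Iio (1 : ℝ)).indicator 1 (√(∑ i, x i ^ 2)) := by
  set τ := (volume : Measure (EuclideanSpace ℝ (Fin (n + 1)))).toSphere with hτ
  have hτ0 : τ Set.univ ≠ 0 := by
    rw [Measure.measure_univ_ne_zero]
    exact Measure.toSphere_ne_zero _
  have hτt : τ Set.univ ≠ ∞ := measure_ne_top _ _
  have hd : ENNReal.ofReal (1 / ((n : ℝ) + 1)) ≠ 0 := by
    have : 0 < 1 / ((n : ℝ) + 1) := by positivity
    simpa using this
  refine ⟨(τ Set.univ)⁻¹ * (ENNReal.ofReal (1 / ((n : ℝ) + 1)))⁻¹, ?_, ?_, fun F hF => ?_⟩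
  · exact mul_ne_zero (ENNReal.inv_ne_zero.2 hτt) (ENNReal.inv_ne_zero.2 ENNReal.ofReal_ne_top)
  · exact ENNReal.mul_ne_top (ENNReal.inv_ne_top.2 hτ0) (ENNReal.inv_ne_top.2 hd)
  have hFm : Measurable fun v : KacSphere (n + 1) => F v.1 := by fun_prop
  rw [uniformSphere, lintegral_smul_measure, lintegral_map hFm (measurable_dilate _), mul_assoc,
    smul_eq_mul]
  congr 1
  have h1 := lintegral_comp_normalize_mul_indicator_ball (volume : Measure (EuclideanSpace ℝ (Fin (n + 1))))
    (H := fun x => F (√(n + 1 : ℕ) • x).ofLp) (by fun_prop)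
  rw [finrank_euclideanSpace_fin, Nat.add_sub_cancel] at h1
  have h2 : ∫⁻ ω, F (dilate (n + 1) ω).1 ∂τ =
      ∫⁻ ω : Metric.sphere (0 : EuclideanSpace ℝ (Fin (n + 1))) 1, F (√(n + 1 : ℕ) • (ω : EuclideanSpace ℝ (Fin (n + 1)))).ofLp ∂τ := rfl
  rw [h2, ← mul_one (lintegral _ _), ← ENNReal.mul_inv_cancel hd ENNReal.ofReal_ne_top, ← mul_assoc,
    ← h1, mul_comm]
  congr 1
  rw [← (PiLp.volume_preserving_toLp (Fin (n + 1))).lintegral_comp]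
  · refine lintegral_congr fun x => ?_
    rw [EuclideanSpace.norm_eq]
    simp only [Real.norm_eq_abs, sq_abs]
    rw [WithLp.ofLp_smul, WithLp.ofLp_smul, smul_smul, div_eq_mul_inv]
  · refine Measurable.mul (by fun_prop) ?_
    exact (measurable_one.indicator measurableSet_Iio).comp measurable_norm

theorem sum_sq_insertNth {n : ℕ} (p : Fin (n + 1)) (z : ℝ) (w : Fin n → ℝ) :
    ∑ i, (p.insertNth (α := fun _ => ℝ) z w) i ^ 2 = (∑ i, w i ^ 2) + z ^ 2 := by
  rw [Fin.sum_univ_succAbove _ p, add_comm]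
  simp

theorem smul_insertNth {n : ℕ} (p : Fin (n + 1)) (a z : ℝ) (w : Fin n → ℝ) :
    a • (p.insertNth (α := fun _ => ℝ) z w) = p.insertNth (α := fun _ => ℝ) (a * z) (a • w) := by
  ext i
  refine Fin.succAboveCases p ?_ (fun j => ?_) i <;> simp

theorem measurable_insertNth {n : ℕ} (p : Fin (n + 1)) {α : Type*} [MeasurableSpace α] {f : α → ℝ}
    {g : α → Fin n → ℝ} (hf : Measurable f) (hg : Measurable g) :
    Measurable fun a => p.insertNth (α := fun _ => ℝ) (f a) (g a) :=
  (MeasurableEquiv.piFinSuccAbove (fun _ => ℝ) p).symm.measurable.comp (hf.prodMk hg)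

theorem lintegral_insertNth {n : ℕ} (p : Fin (n + 1)) (m : Measure ℝ) [SigmaFinite m]
    {F : (Fin (n + 1) → ℝ) → ℝ≥0∞} (hF : Measurable F) :
    ∫⁻ x, F x ∂(Measure.pi fun _ => m) =
      ∫⁻ w, ∫⁻ z, F (p.insertNth (α := fun _ => ℝ) z w) ∂m ∂(Measure.pi fun _ => m) := by
  rw [← (measurePreserving_piFinSuccAbove (fun _ => m) p).symm.lintegral_comp hF]
  exact lintegral_prod_symm' _ (hF.comp (MeasurableEquiv.measurable _))

theorem setLIntegral_eq_of_subset_of_forall_diff_eq_zero {α : Type*} [MeasurableSpace α]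
    {m : Measure α} {s t : Set α} {f : α → ℝ≥0∞} (hs : MeasurableSet s) (ht : MeasurableSet t)
    (hst : s ⊆ t) (h : ∀ x ∈ t \ s, f x = 0) : ∫⁻ x in t, f x ∂m = ∫⁻ x in s, f x ∂m := by
  rw [← lintegral_indicator ht, ← lintegral_indicator hs]
  refine lintegral_congr fun x => ?_
  by_cases hx : x ∈ s
  · rw [Set.indicator_of_mem hx, Set.indicator_of_mem (hst hx)]
  · rw [Set.indicator_of_notMem hx]
    by_cases hx' : x ∈ t
    · rw [Set.indicator_of_mem hx', h x ⟨hx', hx⟩]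
    · rw [Set.indicator_of_notMem hx']

/-- The two sheets of the graph of the sphere over the hyperplane `v_p = 0`, with weights. -/
noncomputable def sheetSum {n : ℕ} (p : Fin (n + 1)) (F : (Fin (n + 1) → ℝ) → ℝ≥0∞) (R : ℝ) (w : Fin n → ℝ) :
    ℝ≥0∞ :=
  ENNReal.ofReal (√(R - ∑ i, w i ^ 2))⁻¹ *
    (F (p.insertNth (α := fun _ => ℝ) (√(R - ∑ i, w i ^ 2)) w) +
      F (p.insertNth (α := fun _ => ℝ) (-√(R - ∑ i, w i ^ 2)) w))

theorem measurable_sheetSum {n : ℕ} (p : Fin (n + 1)) {F : (Fin (n + 1) → ℝ) → ℝ≥0∞}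
    (hF : Measurable F) (R : ℝ) : Measurable (sheetSum p F R) := by
  have h : Measurable fun w : Fin n → ℝ => √(R - ∑ i, w i ^ 2) := by fun_prop
  exact (h.inv.ennreal_ofReal).mul ((hF.comp (measurable_insertNth p h measurable_id)).add
    (hF.comp (measurable_insertNth p h.neg measurable_id)))

/-- Replacing `z` by the radius `r`, the projected point has remaining coordinates `(√R / r) • w`,
and its `p`-th coordinate is one of the two square roots allowed by the sphere. The Jacobian `r /
√(r² - s)` is exactly `√R` times the graph weight at `(√R / r) • w`. -/
theorem lintegral_insertNth_normalize {n : ℕ} (p : Fin (n + 1)) {F : (Fin (n + 1) → ℝ) → ℝ≥0∞}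
    (hF : Measurable F) {R : ℝ} (hR : 0 < R) (w : Fin n → ℝ) :
    ∫⁻ z : ℝ, F ((√R / √((∑ i, w i ^ 2) + z ^ 2)) • p.insertNth (α := fun _ => ℝ) z w) *
        (Set.Iio (1 : ℝ)).indicator 1 (√((∑ i, w i ^ 2) + z ^ 2)) =
      ∫⁻ r in Set.Ioo (0 : ℝ) 1, ENNReal.ofReal (√R) * sheetSum p F R ((√R / r) • w) := by
  set s := ∑ i, w i ^ 2 with hs
  have hs0 : 0 ≤ s := Finset.sum_nonneg fun i _ => sq_nonneg _
  have hmeas : ∀ ε : ℝ, Measurable fun r : ℝ => ENNReal.ofReal (r * (√(r ^ 2 - s))⁻¹) *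
      (F (p.insertNth (α := fun _ => ℝ) (ε * (√R / r * √(r ^ 2 - s))) ((√R / r) • w)) *
        (Set.Iio (1 : ℝ)).indicator 1 r) := by
    intro ε
    have : Measurable ((Set.Iio (1 : ℝ)).indicator (1 : ℝ → ℝ≥0∞)) :=
      measurable_one.indicator measurableSet_Iio
    refine Measurable.mul (by fun_prop) (Measurable.mul (hF.comp ?_) this)
    exact measurable_insertNth p (by fun_prop) (by fun_prop)
  have key : ∀ ε : ℝ, ε ^ 2 = 1 →
      ∫⁻ z in Set.Ioi 0, F ((√R / √(s + (ε * z) ^ 2)) • p.insertNth (α := fun _ => ℝ) (ε * z) w) *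
        (Set.Iio (1 : ℝ)).indicator 1 (√(s + (ε * z) ^ 2)) =
      ∫⁻ r in Set.Ioi √s, ENNReal.ofReal (r * (√(r ^ 2 - s))⁻¹) *
        (F (p.insertNth (α := fun _ => ℝ) (ε * (√R / r * √(r ^ 2 - s))) ((√R / r) • w)) *
          (Set.Iio (1 : ℝ)).indicator 1 r) := by
    intro ε hε
    rw [setLIntegral_Ioi_comp_sqrt_sq_add hs0]
    refine setLIntegral_congr_fun measurableSet_Ioi fun r hr => ?_
    have hr0 : 0 ≤ r := (Real.sqrt_nonneg s).trans (le_of_lt hr)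
    have hr1 : s ≤ r ^ 2 := (Real.sqrt_le_left hr0).1 (le_of_lt hr)
    have : √(s + (ε * √(r ^ 2 - s)) ^ 2) = r := by
      rw [mul_pow, hε, one_mul, Real.sq_sqrt (by linarith), add_sub_cancel, Real.sqrt_sq hr0]
    simp only [this, smul_insertNth]
    rw [mul_left_comm (√R / r) ε]
  have k1 := key 1 (by norm_num)
  have k2 := key (-1) (by norm_num)
  simp only [one_mul, neg_mul] at k1 k2
  rw [lintegral_eq_setLIntegral_Ioi_add_neg, k1, k2]
  have hm1 := hmeas 1
  simp only [one_mul] at hm1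
  rw [← lintegral_add_left hm1]
  have hsub : Set.Ioo √s 1 ⊆ Set.Ioo 0 1 := Set.Ioo_subset_Ioo_left (Real.sqrt_nonneg s)
  -- For `r ≤ √s` the rescaled point lies outside the open ball of radius `√R`; there the real
  -- square root is `0` and so is its inverse, so the weight vanishes by convention.
  have hzero : ∀ r ∈ Set.Ioo (0 : ℝ) 1 \ Set.Ioo (√s) 1,
      ENNReal.ofReal √R * sheetSum p F R ((√R / r) • w) = 0 := by
    rintro r ⟨⟨h0, h1⟩, h2⟩
    have h3 : r ≤ √s := by
      by_contra h
      exact h2 ⟨not_le.1 h, h1⟩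
    have h4 : r ^ 2 ≤ s := (Real.le_sqrt h0.le hs0).1 h3
    have h5 : √(R - ∑ i, ((√R / r) • w) i ^ 2) = 0 := by
      refine Real.sqrt_eq_zero_of_nonpos ?_
      simp only [Pi.smul_apply, smul_eq_mul, mul_pow, ← Finset.mul_sum, ← hs, div_pow,
        Real.sq_sqrt hR.le]
      have : R ≤ R / r ^ 2 * s := by
        rw [div_mul_eq_mul_div, le_div_iff₀ (by positivity)]
        gcongr
      linarith
    rw [sheetSum, h5]
    simp
  have hpt : ∀ r ∈ Set.Ioo √s 1, ENNReal.ofReal √R * sheetSum p F R ((√R / r) • w) =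
      ENNReal.ofReal (r * (√(r ^ 2 - s))⁻¹) *
        (F (p.insertNth (α := fun _ => ℝ) (√R / r * √(r ^ 2 - s)) ((√R / r) • w)) *
          (Set.Iio (1 : ℝ)).indicator 1 r) +
      ENNReal.ofReal (r * (√(r ^ 2 - s))⁻¹) *
        (F (p.insertNth (α := fun _ => ℝ) (-(√R / r * √(r ^ 2 - s))) ((√R / r) • w)) *
          (Set.Iio (1 : ℝ)).indicator 1 r) := by
    rintro r ⟨h0, h1⟩
    have hr0 : 0 < r := (Real.sqrt_nonneg s).trans_lt h0
    have h5 : √(R - ∑ i, ((√R / r) • w) i ^ 2) = √R / r * √(r ^ 2 - s) := by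
      simp only [Pi.smul_apply, smul_eq_mul, mul_pow, ← Finset.mul_sum, ← hs, div_pow,
        Real.sq_sqrt hR.le]
      have : R - R / r ^ 2 * s = (√R / r) ^ 2 * (r ^ 2 - s) := by
        rw [div_pow, Real.sq_sqrt hR.le]
        field_simp
      rw [this, Real.sqrt_mul (by positivity), Real.sqrt_sq (by positivity)]
    have hR' : 0 < √R := Real.sqrt_pos.2 hR
    rw [Set.indicator_of_mem (show r ∈ Set.Iio (1 : ℝ) from h1), sheetSum, h5, ← mul_assoc,
      ← ENNReal.ofReal_mul (Real.sqrt_nonneg R), mul_inv, inv_div]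
    simp only [Pi.one_apply, mul_one]
    rw [← mul_add]
    congr 2
    field_simp
  calc _ = ∫⁻ r in Set.Ioo √s 1, (ENNReal.ofReal (r * (√(r ^ 2 - s))⁻¹) *
        (F (p.insertNth (α := fun _ => ℝ) (√R / r * √(r ^ 2 - s)) ((√R / r) • w)) *
          (Set.Iio (1 : ℝ)).indicator 1 r) +
      ENNReal.ofReal (r * (√(r ^ 2 - s))⁻¹) *
        (F (p.insertNth (α := fun _ => ℝ) (-(√R / r * √(r ^ 2 - s))) ((√R / r) • w)) *
          (Set.Iio (1 : ℝ)).indicator 1 r)) := by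
        refine (setLIntegral_eq_of_subset_of_forall_diff_eq_zero measurableSet_Ioo
          measurableSet_Ioi Set.Ioo_subset_Ioi_self ?_)
        rintro r ⟨h1, h2⟩
        have : r ∉ Set.Iio (1 : ℝ) := fun h => h2 ⟨h1, h⟩
        simp [Set.indicator_of_notMem this]
    _ = ∫⁻ r in Set.Ioo √s 1, ENNReal.ofReal √R * sheetSum p F R ((√R / r) • w) :=
        (setLIntegral_congr_fun measurableSet_Ioo hpt).symm
    _ = _ := (setLIntegral_eq_of_subset_of_forall_diff_eq_zero measurableSet_Ioo
        measurableSet_Ioo hsub hzero).symm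

/-- Integration over the sphere in graph coordinates, over any coordinate hyperplane. -/
theorem exists_lintegral_uniformSphere_eq_sheetSum (n : ℕ) :
    ∃ κ : ℝ≥0∞, κ ≠ 0 ∧ κ ≠ ∞ ∧ ∀ (p : Fin (n + 1)) (F : (Fin (n + 1) → ℝ) → ℝ≥0∞), Measurable F →
      ∫⁻ v : KacSphere (n + 1), F v.1 ∂uniformSphere (n + 1) =
        κ * ∫⁻ w : Fin n → ℝ, sheetSum p F (n + 1 : ℕ) w := by
  obtain ⟨c, hc0, hct, hc⟩ := exists_lintegral_uniformSphere_eq n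
  have hR : (0 : ℝ) < (n + 1 : ℕ) := by positivity
  set R : ℝ := ((n + 1 : ℕ) : ℝ) with hRdef
  -- After exchanging the integrals, undoing the scaling `w ↦ (√R / r) • w` leaves this radial
  -- integral; it does not depend on `p` or `F`, and only its being positive and finite matters.
  set I := ∫⁻ r in Set.Ioo (0 : ℝ) 1, ENNReal.ofReal (((√R / r) ^ n)⁻¹)
  have hI0 : I ≠ 0 := by
    refine (setLIntegral_pos_iff (by fun_prop)).2 ?_ |>.ne'
    have : Function.support (fun r : ℝ => ENNReal.ofReal (((√R / r) ^ n)⁻¹)) ∩ Set.Ioo 0 1 =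
        Set.Ioo 0 1 := by
      refine Set.inter_eq_right.2 fun r hr => ?_
      have h1 := Real.sqrt_pos.2 hR
      have h2 : 0 < r := hr.1
      have : 0 < ((√R / r) ^ n)⁻¹ := by positivity
      simpa using this
    rw [this]
    simp
  have hIt : I ≠ ∞ := by
    have : I ≤ ∫⁻ r in Set.Ioo (0 : ℝ) 1, 1 := by
      refine setLIntegral_mono measurable_const fun r hr => ?_
      refine ENNReal.ofReal_le_one.2 (inv_le_one_of_one_le₀ (one_le_pow₀ ?_))
      have h1 : (1 : ℝ) ≤ √R := Real.one_le_sqrt.2 (by simp [hRdef])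
      rw [one_le_div hr.1]
      linarith [hr.2]
    refine ne_top_of_le_ne_top ?_ this
    simp
  have hs0 : ENNReal.ofReal (√R) ≠ 0 := by simpa using hR
  refine ⟨c * (ENNReal.ofReal (√R) * I), mul_ne_zero hc0 (mul_ne_zero hs0 hI0),
    ENNReal.mul_ne_top hct (ENNReal.mul_ne_top ENNReal.ofReal_ne_top hIt), fun p F hF => ?_⟩
  have hind : Measurable ((Set.Iio (1 : ℝ)).indicator (1 : ℝ → ℝ≥0∞)) :=
    measurable_one.indicator measurableSet_Iio
  rw [hc F hF, mul_assoc, volume_pi, lintegral_insertNth p volume, ← volume_pi]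
  · congr 1
    simp only [sum_sq_insertNth]
    refine (lintegral_congr fun w => lintegral_insertNth_normalize p hF hR w).trans ?_
    have hm : Measurable fun x : (Fin n → ℝ) × ℝ =>
        ENNReal.ofReal √R * sheetSum p F R ((√R / x.2) • x.1) :=
      ((measurable_sheetSum p hF R).comp (by fun_prop)).const_mul _
    rw [lintegral_lintegral_swap hm.aemeasurable]
    calc _ = ∫⁻ r in Set.Ioo (0 : ℝ) 1, ENNReal.ofReal (((√R / r) ^ n)⁻¹) *
          (ENNReal.ofReal √R * ∫⁻ w : Fin n → ℝ, sheetSum p F R w) := by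
          refine setLIntegral_congr_fun measurableSet_Ioo fun r hr => ?_
          have hm' : Measurable fun w : Fin n → ℝ => sheetSum p F R ((√R / r) • w) :=
            (measurable_sheetSum p hF R).comp (by fun_prop)
          rw [lintegral_const_mul _ hm',
            lintegral_comp_smul_pi n (div_pos (Real.sqrt_pos.2 hR) hr.1)
              (measurable_sheetSum p hF R)]
          ring
      _ = _ := by
          rw [lintegral_mul_const _ (by fun_prop)]
          ring
  · exact Measurable.mul (hF.comp (by fun_prop)) (hind.comp (by fun_prop))

/-- The normalising constant of the sphere measure in graph coordinates. -/
noncomputable def sheetConst (n : ℕ) : ℝ≥0∞ :=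
  (exists_lintegral_uniformSphere_eq_sheetSum n).choose

theorem sheetConst_ne_zero (n : ℕ) : sheetConst n ≠ 0 :=
  (exists_lintegral_uniformSphere_eq_sheetSum n).choose_spec.1

theorem sheetConst_ne_top (n : ℕ) : sheetConst n ≠ ∞ :=
  (exists_lintegral_uniformSphere_eq_sheetSum n).choose_spec.2.1

theorem lintegral_uniformSphere {n : ℕ} (p : Fin (n + 1)) {F : (Fin (n + 1) → ℝ) → ℝ≥0∞}
    (hF : Measurable F) :
    ∫⁻ v : KacSphere (n + 1), F v.1 ∂uniformSphere (n + 1) =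
      sheetConst n * ∫⁻ w : Fin n → ℝ, sheetSum p F (n + 1 : ℕ) w :=
  (exists_lintegral_uniformSphere_eq_sheetSum n).choose_spec.2.2 p F hF

/-! ### Upper bound for product densities on the sphere. -/

theorem lintegral_pi_prod (m : Measure ℝ) [SigmaFinite m] {n : ℕ} {f : Fin n → ℝ → ℝ≥0∞}
    (hf : ∀ i, Measurable (f i)) :
    ∫⁻ x, ∏ i, f i (x i) ∂(Measure.pi fun _ => m) = ∏ i, ∫⁻ t, f i t ∂m := by
  induction n with
  | zero => simp
  | succ n ih =>
    have hm : Measurable fun x : Fin (n + 1) → ℝ => ∏ i, f i (x i) :=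
      Finset.measurable_prod _ fun i _ => (hf i).comp (measurable_pi_apply i)
    rw [lintegral_insertNth 0 m hm, Fin.prod_univ_succ, ← ih fun i => hf i.succ,
      ← lintegral_const_mul _
        (Finset.measurable_prod _ fun i _ => (hf i.succ).comp (measurable_pi_apply i))]
    refine lintegral_congr fun w => ?_
    simp only [Fin.prod_univ_succ, Fin.insertNth_zero', Fin.cons_zero, Fin.cons_succ]
    rw [lintegral_mul_const _ (hf 0)]

theorem lintegral_pi_withDensity {G : ℝ → ℝ≥0∞} (hG : Measurable G)
    [SigmaFinite (volume.withDensity G)] {n : ℕ} {F : (Fin n → ℝ) → ℝ≥0∞} (hF : Measurable F) :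
    ∫⁻ w, F w ∂(Measure.pi fun _ => volume.withDensity G) =
      ∫⁻ w : Fin n → ℝ, (∏ i, G (w i)) * F w := by
  induction n with
  | zero => simp [volume_pi, lintegral_unique]
  | succ n ih =>
    have hm : ∀ k : ℕ, Measurable fun x : Fin k → ℝ => ∏ i, G (x i) := fun k =>
      Finset.measurable_prod _ fun i _ => hG.comp (measurable_pi_apply i)
    have hi : Measurable fun x : (Fin n → ℝ) × ℝ =>
        F ((0 : Fin (n + 1)).insertNth (α := fun _ => ℝ) x.2 x.1) :=
      hF.comp (measurable_insertNth 0 measurable_snd measurable_fst)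
    rw [lintegral_insertNth 0 _ hF, ih hi.lintegral_prod_right', volume_pi, volume_pi,
      lintegral_insertNth 0 volume (F := fun x => (∏ i, G (x i)) * F x) ((hm _).mul hF)]
    refine lintegral_congr fun w => ?_
    have h1 : Measurable fun z : ℝ => F ((0 : Fin (n + 1)).insertNth (α := fun _ => ℝ) z w) :=
      hi.comp (by fun_prop : Measurable fun z : ℝ => (w, z))
    rw [lintegral_withDensity_eq_lintegral_mul _ hG h1, ← lintegral_const_mul _ (hG.mul h1)]
    refine lintegral_congr fun z => ?_
    simp only [Pi.mul_apply, Fin.prod_univ_succ, Fin.insertNth_zero', Fin.cons_zero,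
      Fin.cons_succ]
    ring

theorem lintegral_fin_add_mul {a b : ℕ} {F : (Fin a → ℝ) → ℝ≥0∞} {H : (Fin b → ℝ) → ℝ≥0∞}
    (hF : Measurable F) (hH : Measurable H) :
    ∫⁻ x : Fin (a + b) → ℝ, F (fun i => x (Fin.castAdd b i)) * H (fun i => x (Fin.natAdd a i)) =
      (∫⁻ y, F y) * ∫⁻ z, H z := by
  have h1 := (volume_measurePreserving_sumPiEquivProdPi_symm (fun _ : Fin a ⊕ Fin b => ℝ))
  have h2 := volume_measurePreserving_piCongrLeft (fun _ : Fin (a + b) => ℝ) finSumFinEquiv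
  have hm : Measurable fun x : Fin (a + b) → ℝ =>
      F (fun i => x (Fin.castAdd b i)) * H (fun i => x (Fin.natAdd a i)) := by fun_prop
  rw [← (h2.comp h1).lintegral_comp hm, Measure.volume_eq_prod, ← lintegral_prod_mul (by fun_prop)
    (by fun_prop)]
  refine lintegral_congr fun x => ?_
  congr 2
  · ext i
    have := MeasurableEquiv.piCongrLeft_apply_apply (β := fun _ : Fin (a + b) => ℝ)
      (e := finSumFinEquiv) (x := (MeasurableEquiv.sumPiEquivProdPi fun _ => ℝ).symm x)
      (i := Sum.inl i)
    exact this
  · ext i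
    have := MeasurableEquiv.piCongrLeft_apply_apply (β := fun _ : Fin (a + b) => ℝ)
      (e := finSumFinEquiv) (x := (MeasurableEquiv.sumPiEquivProdPi fun _ => ℝ).symm x)
      (i := Sum.inr i)
    exact this

/-- The substitution `x = √a sin θ` turns the integrand into `1` on an interval of length `π`. The
bound is uniform in `a`, so the graph weight can be integrated out along one coordinate whatever the
others are. -/
theorem lintegral_inv_sqrt_sub_sq_le (a : ℝ) :
    ∫⁻ x : ℝ, ENNReal.ofReal (√(a - x ^ 2))⁻¹ ≤ ENNReal.ofReal Real.pi := by
  rcases le_or_gt a 0 with ha | ha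
  · have : ∀ x : ℝ, √(a - x ^ 2) = 0 := fun x =>
      Real.sqrt_eq_zero_of_nonpos (by nlinarith [sq_nonneg x])
    simp [this]
  have hsa : 0 < √a := Real.sqrt_pos.2 ha
  set s := Set.Ioo (-(Real.pi / 2)) (Real.pi / 2)
  have hsupp : ∫⁻ x : ℝ, ENNReal.ofReal (√(a - x ^ 2))⁻¹ =
      ∫⁻ x in (fun θ => √a * Real.sin θ) '' s, ENNReal.ofReal (√(a - x ^ 2))⁻¹ := by
    rw [← setLIntegral_univ]
    refine setLIntegral_eq_of_subset_of_forall_diff_eq_zero ?_ .univ (Set.subset_univ _) ?_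
    · refine measurableSet_Ioo.image_of_continuousOn_injOn (by fun_prop) ?_
      exact fun x hx y hy h => Real.injOn_sin (Set.Ioo_subset_Icc_self hx)
        (Set.Ioo_subset_Icc_self hy) (mul_left_cancel₀ hsa.ne' h)
    · rintro x ⟨-, hx⟩
      have : √(a - x ^ 2) = 0 := by
        refine Real.sqrt_eq_zero_of_nonpos ?_
        by_contra hlt
        have h1 : |x| < √a := by
          rw [Real.lt_sqrt (abs_nonneg x), sq_abs]
          linarith
        have h2 : |x / √a| < 1 := by
          rwa [abs_div, abs_of_pos hsa, div_lt_one hsa]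
        refine hx ⟨Real.arcsin (x / √a), ⟨?_, ?_⟩, ?_⟩
        · exact Real.neg_pi_div_two_lt_arcsin.2 (abs_lt.1 h2).1
        · exact Real.arcsin_lt_pi_div_two.2 (abs_lt.1 h2).2
        · simp only
          rw [Real.sin_arcsin (abs_lt.1 h2).1.le (abs_lt.1 h2).2.le, mul_div_cancel₀ _ hsa.ne']
      rw [this]
      simp
  rw [hsupp, lintegral_image_eq_lintegral_abs_deriv_mul (f' := fun θ => √a * Real.cos θ)
    measurableSet_Ioo]
  · calc _ ≤ ∫⁻ θ in s, 1 := by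
          refine setLIntegral_mono measurable_const fun θ hθ => ?_
          have hc : 0 < Real.cos θ := Real.cos_pos_of_mem_Ioo hθ
          have h1 : a - (√a * Real.sin θ) ^ 2 = (√a * Real.cos θ) ^ 2 := by
            rw [mul_pow, mul_pow, Real.sq_sqrt ha.le, Real.cos_sq']
            ring
          rw [h1, Real.sqrt_sq (by positivity), abs_of_pos (by positivity),
            ← ENNReal.ofReal_mul (by positivity), mul_inv_cancel₀ (by positivity)]
          simp
      _ ≤ _ := by
          simp only [setLIntegral_one, s, Real.volume_Ioo]
          apply le_of_eq
          congr 1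
          ring
  · intro θ _
    exact ((Real.hasDerivAt_sin θ).const_mul _).hasDerivWithinAt
  · exact fun x hx y hy h => Real.injOn_sin (Set.Ioo_subset_Icc_self hx)
      (Set.Ioo_subset_Icc_self hy) (mul_left_cancel₀ hsa.ne' h)

/-- The indicator of `[0, 1]`, a probability density. -/
noncomputable def unitInd : ℝ → ℝ≥0∞ := (Set.Icc (0 : ℝ) 1).indicator 1

theorem measurable_unitInd : Measurable unitInd := measurable_one.indicator measurableSet_Icc

theorem lintegral_unitInd : ∫⁻ x, unitInd x = 1 := by
  simp [unitInd, lintegral_indicator_one measurableSet_Icc]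

/-- Integrate in `w q` first, where only the weight varies. The factor `unitInd`, of integral one,
is a placeholder that keeps both sides integrals over the same space. -/
theorem lintegral_mul_inv_sqrt_le {n : ℕ} (q : Fin n) (R : ℝ) {Φ : (Fin n → ℝ) → ℝ≥0∞}
    (hΦ : Measurable Φ) (hq : ∀ w x, Φ (Function.update w q x) = Φ w) :
    ∫⁻ w : Fin n → ℝ, ENNReal.ofReal (√(R - ∑ i, w i ^ 2))⁻¹ * Φ w ≤
      ENNReal.ofReal Real.pi * ∫⁻ w : Fin n → ℝ, Φ w * unitInd (w q) := by
  have hu := measurable_unitInd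
  rw [← lintegral_const_mul _ (by fun_prop), volume_pi]
  refine lintegral_le_of_lmarginal_le {q} (by fun_prop) (by fun_prop) fun w => ?_
  rw [lmarginal_singleton, lmarginal_singleton]
  have hsum : ∀ t, ∑ i, Function.update w q t i ^ 2 = t ^ 2 + ∑ i ∈ Finset.univ.erase q, w i ^ 2 := by
    intro t
    rw [← Finset.add_sum_erase _ _ (Finset.mem_univ q), Function.update_self]
    congr 1
    refine Finset.sum_congr rfl fun i hi => ?_
    rw [Function.update_of_ne (Finset.ne_of_mem_erase hi)]
  simp only [hq, hsum, Function.update_self]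
  rw [lintegral_mul_const _ (by fun_prop), lintegral_const_mul _ (by fun_prop),
    lintegral_const_mul _ hu, lintegral_unitInd, mul_one]
  gcongr
  refine le_trans (le_of_eq ?_) (lintegral_inv_sqrt_sub_sq_le
    (R - ∑ i ∈ Finset.univ.erase q, w i ^ 2))
  refine lintegral_congr fun t => ?_
  congr 3
  ring

/-- A function on the sphere that ignores two coordinates is integrated, up to a constant, as with
respect to Lebesgue measure in the remaining ones. -/
theorem lintegral_uniformSphere_le {n : ℕ} {p p' : Fin (n + 1)} (hpp : p ≠ p')
    {Ψ : (Fin (n + 1) → ℝ) → ℝ≥0∞} (hΨ : Measurable Ψ)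
    (hp : ∀ v x, Ψ (Function.update v p x) = Ψ v)
    (hp' : ∀ v x, Ψ (Function.update v p' x) = Ψ v) :
    ∫⁻ v : KacSphere (n + 1), Ψ v.1 ∂uniformSphere (n + 1) ≤
      sheetConst n * (ENNReal.ofReal (2 * Real.pi) *
        ∫⁻ v : Fin (n + 1) → ℝ, Ψ v * (unitInd (v p) * unitInd (v p'))) := by
  have hu := measurable_unitInd
  obtain ⟨q, rfl⟩ := Fin.exists_succAbove_eq hpp.symm
  have hins : ∀ (z : ℝ) (w : Fin n → ℝ), Ψ (p.insertNth (α := fun _ => ℝ) z w) =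
      Ψ (p.insertNth (α := fun _ => ℝ) 0 w) := by
    intro z w
    rw [← hp (p.insertNth (α := fun _ => ℝ) 0 w) z, Fin.update_insertNth]
  have hm : Measurable fun w : Fin n → ℝ => Ψ (p.insertNth (α := fun _ => ℝ) 0 w) :=
    hΨ.comp (measurable_insertNth p measurable_const measurable_id)
  rw [lintegral_uniformSphere p hΨ]
  gcongr
  rw [volume_pi, volume_pi, lintegral_insertNth p volume (by fun_prop), ← volume_pi]
  have h1 : ∀ w : Fin n → ℝ, ∫⁻ z, Ψ (p.insertNth (α := fun _ => ℝ) z w) *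
      (unitInd ((p.insertNth (α := fun _ => ℝ) z w : Fin (n + 1) → ℝ) p) *
        unitInd ((p.insertNth (α := fun _ => ℝ) z w : Fin (n + 1) → ℝ) (p.succAbove q))) =
      Ψ (p.insertNth (α := fun _ => ℝ) 0 w) * unitInd (w q) := by
    intro w
    simp only [hins _ w, Fin.insertNth_apply_same, Fin.insertNth_apply_succAbove]
    rw [lintegral_const_mul _ (by fun_prop), lintegral_mul_const _ hu, lintegral_unitInd, one_mul]
  simp_rw [h1]
  have h2 : ∀ w : Fin n → ℝ, sheetSum p Ψ (n + 1 : ℕ) w =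
      2 * (ENNReal.ofReal (√((n + 1 : ℕ) - ∑ i, w i ^ 2))⁻¹ *
        Ψ (p.insertNth (α := fun _ => ℝ) 0 w)) := by
    intro w
    rw [sheetSum, hins _ w, hins (-_) w]
    ring
  simp_rw [h2]
  rw [lintegral_const_mul _ (by fun_prop), ENNReal.ofReal_mul zero_le_two, ENNReal.ofReal_ofNat,
    mul_assoc]
  gcongr
  refine lintegral_mul_inv_sqrt_le q _ hm fun w x => ?_
  rw [← hp' (p.insertNth (α := fun _ => ℝ) 0 w) x]
  congr 1
  ext i
  refine Fin.succAboveCases p ?_ (fun j => ?_) i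
  · simp
  · by_cases h : j = q
    · subst h
      simp
    · simp [h]

/-- Each of the two smallest factors is at most the geometric mean of the other `d`. Summing over
all ordered pairs avoids having to know which two are smallest, and every term ignores two
coordinates. -/
theorem prod_le_sum_prod_erase_rpow {d : ℕ} (hd : d ≠ 0) (x : Fin (d + 2) → ℝ≥0∞) :
    ∏ j, x j ≤ ∑ i, ∑ i' ∈ Finset.univ.erase i,
      ∏ j ∈ (Finset.univ.erase i).erase i', x j ^ (1 + 2 / (d : ℝ)) := by
  obtain ⟨i, hi⟩ := Finite.exists_min x
  have hne : (Finset.univ.erase i).Nonempty := by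
    rw [← Finset.card_pos, Finset.card_erase_of_mem (Finset.mem_univ _)]
    simp
  obtain ⟨i', hi'm, hi'⟩ := Finset.exists_min_image _ x hne
  set s := (Finset.univ.erase i).erase i' with hs
  have hcard : s.card = d := by
    rw [Finset.card_erase_of_mem hi'm, Finset.card_erase_of_mem (Finset.mem_univ _)]
    simp
  have hd0 : (d : ℝ) ≠ 0 := by exact_mod_cast hd
  have hroot : ∀ y : ℝ≥0∞, (∀ j ∈ s, y ≤ x j) → y ≤ (∏ j ∈ s, x j) ^ (1 / (d : ℝ)) := by
    intro y hy
    have h1 : y ^ d ≤ ∏ j ∈ s, x j := by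
      calc y ^ d = y ^ s.card := by rw [hcard]
        _ ≤ _ := Finset.pow_card_le_prod _ _ _ hy
    calc y = (y ^ d) ^ (1 / (d : ℝ)) := by
          rw [← ENNReal.rpow_natCast, ← ENNReal.rpow_mul, mul_one_div_cancel hd0, ENNReal.rpow_one]
      _ ≤ _ := ENNReal.rpow_le_rpow h1 (by positivity)
  have h1 := hroot (x i) fun j _ => hi j
  have h2 := hroot (x i') fun j hj => hi' j (Finset.mem_of_mem_erase hj)
  calc ∏ j, x j = x i * (x i' * ∏ j ∈ s, x j) := by
        rw [Finset.mul_prod_erase _ _ hi'm, Finset.mul_prod_erase _ _ (Finset.mem_univ i)]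
    _ ≤ (∏ j ∈ s, x j) ^ (1 / (d : ℝ)) * ((∏ j ∈ s, x j) ^ (1 / (d : ℝ)) * ∏ j ∈ s, x j) := by
        gcongr
    _ = (∏ j ∈ s, x j) ^ (1 + 2 / (d : ℝ)) := by
        nth_rw 3 [← ENNReal.rpow_one (∏ j ∈ s, x j)]
        rw [← ENNReal.rpow_add_of_nonneg _ _ (by positivity) zero_le_one,
          ← ENNReal.rpow_add_of_nonneg _ _ (by positivity) (by positivity)]
        congr 1
        ring
    _ = ∏ j ∈ s, x j ^ (1 + 2 / (d : ℝ)) :=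
        (ENNReal.prod_rpow_of_nonneg (by positivity)).symm
    _ ≤ ∑ i' ∈ Finset.univ.erase i,
          ∏ j ∈ (Finset.univ.erase i).erase i', x j ^ (1 + 2 / (d : ℝ)) :=
        Finset.single_le_sum (f := fun i' => ∏ j ∈ (Finset.univ.erase i).erase i',
          x j ^ (1 + 2 / (d : ℝ))) (fun _ _ => bot_le) hi'm
    _ ≤ _ := Finset.single_le_sum (f := fun i => ∑ i' ∈ Finset.univ.erase i,
          ∏ j ∈ (Finset.univ.erase i).erase i', x j ^ (1 + 2 / (d : ℝ)))
          (fun _ _ => bot_le) (Finset.mem_univ i)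

theorem lintegral_prod_erase_mul_unitInd {h : ℝ → ℝ≥0∞} (hh : Measurable h) {d : ℕ}
    {i i' : Fin (d + 2)} (hi : i' ∈ Finset.univ.erase i) :
    ∫⁻ z : Fin (d + 2) → ℝ, (∏ j ∈ (Finset.univ.erase i).erase i', h (z j)) *
      (unitInd (z i) * unitInd (z i')) = (∫⁻ t, h t) ^ d := by
  have hu := measurable_unitInd
  set s := (Finset.univ.erase i).erase i' with hs
  have hcard : s.card = d := by
    rw [Finset.card_erase_of_mem hi, Finset.card_erase_of_mem (Finset.mem_univ _)]
    simp
  have hii : i' ≠ i := Finset.ne_of_mem_erase hi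
  set f : Fin (d + 2) → ℝ → ℝ≥0∞ := fun j => if j ∈ s then h else unitInd with hf
  have hfm : ∀ j, Measurable (f j) := fun j => by
    simp only [hf]
    split_ifs <;> assumption
  have hsplit : ∀ y : Fin (d + 2) → ℝ≥0∞, ∏ j, y j = (∏ j ∈ s, y j) * (y i * y i') := by
    intro y
    rw [← Finset.mul_prod_erase _ _ (Finset.mem_univ i), ← Finset.mul_prod_erase _ _ hi]
    ring
  have hfi : f i = unitInd := if_neg (by simp [hs])
  have hfi' : f i' = unitInd := if_neg (by simp [hs])
  have hfs : ∀ j ∈ s, f j = h := fun j hj => if_pos hj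
  have := lintegral_pi_prod volume hfm
  rw [hsplit, hfi, hfi', lintegral_unitInd, Finset.prod_congr rfl fun j hj => by rw [hfs j hj],
    Finset.prod_const, hcard, mul_one, mul_one] at this
  rw [← this, volume_pi]
  refine lintegral_congr fun z => ?_
  rw [hsplit, hfi, hfi']
  congr 1
  exact Finset.prod_congr rfl fun j hj => by rw [hfs j hj]

/-- Upper bound for integrals of product densities over the sphere: up to the constant of the
graph coordinates, they are bounded by integrals with respect to the product measure. -/
theorem lintegral_uniformSphere_prod_mul_le {G : ℝ → ℝ≥0∞} (hG : Measurable G)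
    [SigmaFinite (volume.withDensity G)] {d : ℕ} (hd : d ≠ 0) (N : ℕ) {R : (Fin N → ℝ) → ℝ≥0∞}
    (hR : Measurable R) :
    ∫⁻ v : KacSphere (N + (d + 2)), (∏ j, G (v.1 j)) * R (fun i => v.1 (Fin.castAdd (d + 2) i))
        ∂uniformSphere (N + (d + 2)) ≤
      sheetConst (N + (d + 1)) * (((d + 2 : ℕ) * ((d + 1 : ℕ) * (ENNReal.ofReal (2 * Real.pi) *
        (∫⁻ t, G t ^ (1 + 2 / (d : ℝ))) ^ d))) *
          ∫⁻ y, R y ∂(Measure.pi fun _ => volume.withDensity G)) := by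
  have hu := measurable_unitInd
  set q : ℝ := 1 + 2 / (d : ℝ)
  -- The first `N` coordinates keep their densities intact, so they reproduce the product measure;
  -- only the `d + 2` spare ones are sacrificed.
  set Ψ : Fin (d + 2) → Fin (d + 2) → (Fin (N + (d + 2)) → ℝ) → ℝ≥0∞ := fun i i' v =>
    ((∏ j : Fin N, G (v (Fin.castAdd (d + 2) j))) * R (fun i => v (Fin.castAdd (d + 2) i))) *
      ∏ j ∈ (Finset.univ.erase i).erase i', G (v (Fin.natAdd N j)) ^ q with hΨ
  have hΨm : ∀ i i', Measurable (Ψ i i') := fun i i' => by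
    simp only [hΨ]
    fun_prop
  have hterm : ∀ i, ∀ i' ∈ Finset.univ.erase i,
      ∫⁻ v : KacSphere (N + (d + 2)), Ψ i i' v.1 ∂uniformSphere (N + (d + 2)) ≤
        sheetConst (N + (d + 1)) * (ENNReal.ofReal (2 * Real.pi) *
          ((∫⁻ y, R y ∂(Measure.pi fun _ => volume.withDensity G)) * (∫⁻ t, G t ^ q) ^ d)) := by
    intro i i' hi
    have hii : i' ≠ i := Finset.ne_of_mem_erase hi
    have hupd : ∀ k : Fin (d + 2), k ∉ (Finset.univ.erase i).erase i' → ∀ v x,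
        Ψ i i' (Function.update v (Fin.natAdd N k) x) = Ψ i i' v := by
      intro k hk v x
      have h1 : ∀ j : Fin N, Function.update v (Fin.natAdd N k) x (Fin.castAdd (d + 2) j) =
          v (Fin.castAdd (d + 2) j) := fun j =>
        Function.update_of_ne (by simp [Fin.ext_iff]; omega) _ _
      simp only [hΨ, h1]
      congr 1
      refine Finset.prod_congr rfl fun j hj => ?_
      rw [Function.update_of_ne]
      intro h
      have := Fin.natAdd_injective _ _ h
      exact hk (this ▸ hj)
    have h := lintegral_uniformSphere_le (n := N + (d + 1)) (p := Fin.natAdd N i)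
      (p' := Fin.natAdd N i') (fun h => hii (Fin.natAdd_injective _ _ h).symm) (hΨm i i')
      (hupd i (by simp)) (hupd i' (by simp))
    refine h.trans (le_of_eq ?_)
    congr 2
    rw [lintegral_pi_withDensity hG hR, ← lintegral_prod_erase_mul_unitInd (hG.pow_const q) hi,
      ← lintegral_fin_add_mul (by fun_prop) (by fun_prop)]
    refine lintegral_congr fun v => ?_
    simp only [hΨ, mul_assoc]
  have hpt : ∀ v : Fin (N + (d + 2)) → ℝ,
      (∏ j, G (v j)) * R (fun i => v (Fin.castAdd (d + 2) i)) ≤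
        ∑ i, ∑ i' ∈ Finset.univ.erase i, Ψ i i' v := by
    intro v
    rw [Fin.prod_univ_add, mul_right_comm]
    simp only [hΨ, ← Finset.mul_sum]
    gcongr
    exact prod_le_sum_prod_erase_rpow hd _
  calc _ ≤ ∫⁻ v : KacSphere (N + (d + 2)), ∑ i, ∑ i' ∈ Finset.univ.erase i, Ψ i i' v.1
        ∂uniformSphere (N + (d + 2)) := lintegral_mono fun v => hpt v.1
    _ = ∑ i, ∑ i' ∈ Finset.univ.erase i,
          ∫⁻ v : KacSphere (N + (d + 2)), Ψ i i' v.1 ∂uniformSphere (N + (d + 2)) := by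
        have hm : ∀ i i', Measurable fun v : KacSphere (N + (d + 2)) => Ψ i i' v.1 := fun i i' =>
          (hΨm i i').comp (by fun_prop)
        rw [lintegral_finsetSum _ fun i _ => Finset.measurable_sum _ fun i' _ => hm i i']
        exact Finset.sum_congr rfl fun i _ => lintegral_finsetSum _ fun i' _ => hm i i'
    _ ≤ ∑ i : Fin (d + 2), ∑ i' ∈ Finset.univ.erase i, sheetConst (N + (d + 1)) *
          (ENNReal.ofReal (2 * Real.pi) *
          ((∫⁻ y, R y ∂(Measure.pi fun _ => volume.withDensity G)) * (∫⁻ t, G t ^ q) ^ d)) :=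
        Finset.sum_le_sum fun i _ => Finset.sum_le_sum fun i' hi => hterm i i' hi
    _ = _ := by
        simp only [Finset.sum_const, Finset.card_erase_of_mem (Finset.mem_univ _),
          Finset.card_univ, Fintype.card_fin, nsmul_eq_mul, Nat.add_succ_sub_one]
        ring

/-- Take `d` with `1 + 2 / d < p`. The set `|g| > 1` has finite measure, so `L^p` embeds in the
smaller exponent there; off it the power is dominated by `|g|`. -/
theorem exists_lintegral_ofReal_rpow_lt_top {g : ℝ → ℝ} (hg_meas : Measurable g)
    (hg : Integrable g) {p : ℝ≥0∞} (hp : 1 < p) (hgp : MemLp g p) :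
    ∃ d : ℕ, d ≠ 0 ∧ ∫⁻ t, ENNReal.ofReal (g t) ^ (1 + 2 / (d : ℝ)) < ∞ := by
  have hlim : Tendsto (fun d : ℕ => ENNReal.ofReal (1 + 2 / (d : ℝ))) atTop (𝓝 1) := by
    have : Tendsto (fun d : ℕ => 1 + 2 / (d : ℝ)) atTop (𝓝 (1 + 0)) :=
      tendsto_const_nhds.add (tendsto_const_div_atTop_nhds_zero_nat 2)
    simpa using ENNReal.tendsto_ofReal this
  obtain ⟨d, hdp, hd0⟩ := ((hlim.eventually_lt_const hp).and (eventually_ne_atTop 0)).exists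
  refine ⟨d, hd0, ?_⟩
  set q : ℝ := 1 + 2 / (d : ℝ)
  have hq : 0 < q := by positivity
  have h1q : (1 : ℝ≥0∞) ≤ ENNReal.ofReal q := by
    rw [ENNReal.one_le_ofReal]
    simp only [q, le_add_iff_nonneg_right]
    positivity
  set S : Set ℝ := {t | 1 < ‖g t‖}
  have hS : MeasurableSet S := measurableSet_lt measurable_const hg_meas.norm
  have hSfin : IsFiniteMeasure (volume.restrict S) :=
    ⟨by rw [Measure.restrict_apply_univ]; exact hg.measure_norm_gt_lt_top one_pos⟩
  have hmem : MemLp g (ENNReal.ofReal q) (volume.restrict S) :=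
    (hgp.restrict S).mono_exponent hdp.le
  have h1 := hmem.eLpNorm_lt_top
  rw [eLpNorm_lt_top_iff_lintegral_rpow_enorm_lt_top (by simpa using hq) ENNReal.ofReal_ne_top,
    ENNReal.toReal_ofReal hq.le] at h1
  have hle : ∀ t, ENNReal.ofReal (g t) ≤ ‖g t‖ₑ := fun t => by
    rw [Real.enorm_eq_ofReal_abs]
    exact ENNReal.ofReal_le_ofReal (le_abs_self _)
  rw [← lintegral_add_compl _ hS]
  refine ENNReal.add_lt_top.2 ⟨lt_of_le_of_lt (lintegral_mono fun t => ?_) h1,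
    lt_of_le_of_lt (setLIntegral_mono (g := fun t => ‖g t‖ₑ) (by fun_prop) fun t ht => ?_)
      ((setLIntegral_le_lintegral _ _).trans_lt hg.2)⟩
  · gcongr
    exact hle t
  · have h2 : ENNReal.ofReal (g t) ≤ 1 := by
      rw [ENNReal.ofReal_le_one]
      exact (le_abs_self _).trans (not_lt.1 ht)
    calc ENNReal.ofReal (g t) ^ q ≤ ENNReal.ofReal (g t) ^ (1 : ℝ) := by
          refine ENNReal.rpow_le_rpow_of_exponent_ge h2 ?_
          simpa using h1q
      _ ≤ _ := by
          rw [ENNReal.rpow_one]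
          exact hle t

/-! ### The partition function as a density of a sum of squares. -/

/-- Twice the density of `v ^ 2`, where `v` has density `G`. -/
noncomputable def sqDensity (G : ℝ → ℝ≥0∞) (s : ℝ) : ℝ≥0∞ :=
  ENNReal.ofReal (√s)⁻¹ * (G (√s) + G (-√s))

/-- Convolution of a function with the law of `v ^ 2`. -/
noncomputable def sqConv (m : Measure ℝ) (Φ : ℝ → ℝ≥0∞) (s : ℝ) : ℝ≥0∞ := ∫⁻ v, Φ (s - v ^ 2) ∂m

theorem measurable_sqDensity {G : ℝ → ℝ≥0∞} (hG : Measurable G) : Measurable (sqDensity G) := by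
  unfold sqDensity
  fun_prop

theorem measurable_sqConv (m : Measure ℝ) [SFinite m] {Φ : ℝ → ℝ≥0∞} (hΦ : Measurable Φ) :
    Measurable (sqConv m Φ) := by
  have : Measurable fun x : ℝ × ℝ => Φ (x.1 - x.2 ^ 2) := by fun_prop
  exact this.lintegral_prod_right'

theorem measurable_sqConv_iterate (m : Measure ℝ) [SFinite m] {Φ : ℝ → ℝ≥0∞} (hΦ : Measurable Φ)
    (n : ℕ) : Measurable ((sqConv m)^[n] Φ) := by
  induction n with
  | zero => exact hΦ
  | succ n ih =>
    rw [Function.iterate_succ_apply']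
    exact measurable_sqConv m ih

theorem sqConv_iterate_eq (m : Measure ℝ) [SigmaFinite m] {Φ : ℝ → ℝ≥0∞} (hΦ : Measurable Φ)
    (n : ℕ) (s : ℝ) :
    (sqConv m)^[n] Φ s = ∫⁻ w : Fin n → ℝ, Φ (s - ∑ i, w i ^ 2) ∂(Measure.pi fun _ => m) := by
  induction n generalizing Φ with
  | zero => simp [lintegral_unique]
  | succ n ih =>
    rw [Function.iterate_succ_apply, ih (measurable_sqConv m hΦ), lintegral_insertNth 0 m (by fun_prop)]
    refine lintegral_congr fun w => ?_
    simp only [sum_sq_insertNth, sqConv, sub_sub]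

theorem lintegral_sq_withDensity {G : ℝ → ℝ≥0∞} (hG : Measurable G) {Φ : ℝ → ℝ≥0∞}
    (hΦ : Measurable Φ) :
    ∫⁻ v, Φ (v ^ 2) ∂(volume.withDensity G) = 2⁻¹ * ∫⁻ t, Φ t * sqDensity G t := by
  have himg : Real.sqrt '' Set.Ioi 0 = Set.Ioi 0 := by
    ext z
    constructor
    · rintro ⟨t, ht, rfl⟩
      exact Real.sqrt_pos.2 ht
    · intro hz
      exact ⟨z ^ 2, Set.mem_Ioi.2 (pow_pos hz 2), Real.sqrt_sq (le_of_lt hz)⟩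
  rw [lintegral_withDensity_eq_lintegral_mul _ hG (by fun_prop),
    lintegral_eq_setLIntegral_Ioi_add_neg, ← lintegral_add_left (by fun_prop), ← himg,
    lintegral_image_eq_lintegral_abs_deriv_mul (f' := fun t => 1 / (2 * √t)) measurableSet_Ioi]
  · rw [← lintegral_const_mul _ (f := fun t => Φ t * sqDensity G t)
      (hΦ.mul (measurable_sqDensity hG)), ← setLIntegral_univ (μ := volume)
      (fun t => 2⁻¹ * (Φ t * sqDensity G t)),
      setLIntegral_eq_of_subset_of_forall_diff_eq_zero measurableSet_Ioi .univ
        (Set.subset_univ (Set.Ioi (0 : ℝ)))]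
    · refine setLIntegral_congr_fun measurableSet_Ioi fun t ht => ?_
      have ht0 : (0 : ℝ) < t := ht
      have h2 : ENNReal.ofReal |1 / (2 * √t)| = 2⁻¹ * ENNReal.ofReal (√t)⁻¹ := by
        rw [abs_of_nonneg (by positivity), one_div, mul_inv, ENNReal.ofReal_mul (by positivity),
          ENNReal.ofReal_inv_of_pos two_pos, ENNReal.ofReal_ofNat]
      simp only [Pi.mul_apply, neg_sq, Real.sq_sqrt ht0.le, h2, sqDensity]
      ring
    -- For `t ≤ 0` the convention `0⁻¹ = 0` makes `sqDensity` vanish, as the density of a square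
    -- should.
    · rintro t ⟨-, ht⟩
      have : √t = 0 := Real.sqrt_eq_zero_of_nonpos (not_lt.1 ht)
      simp [sqDensity, this]
  · intro t ht
    exact (Real.hasDerivAt_sqrt (ne_of_gt ht)).hasDerivWithinAt
  · intro t ht t' ht' h
    exact (Real.sqrt_inj (le_of_lt ht) (le_of_lt ht')).1 h

theorem sqConv_eq {G : ℝ → ℝ≥0∞} (hG : Measurable G) {Φ : ℝ → ℝ≥0∞} (hΦ : Measurable Φ) (s : ℝ) :
    sqConv (volume.withDensity G) Φ s = 2⁻¹ * ∫⁻ t, Φ t * sqDensity G (s - t) := by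
  have hf := measurable_sqDensity hG
  rw [sqConv, lintegral_sq_withDensity hG (Φ := fun t => Φ (s - t)) (by fun_prop),
    ← lintegral_sub_left_eq_self (fun t => Φ t * sqDensity G (s - t)) s]
  simp

/-- A sum of `n + 1` squares has density half of the iterate of `sqDensity`, so convolution with its
law is a Lebesgue convolution. With `Φ` itself a `sumDensity`, this convolves the densities of two
independent groups of summands. -/
theorem sqConv_iterate_succ_eq {G : ℝ → ℝ≥0∞} (hG : Measurable G)
    {Φ : ℝ → ℝ≥0∞} (hΦ : Measurable Φ) (n : ℕ) (s : ℝ) :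
    (sqConv (volume.withDensity G))^[n + 1] Φ s =
      2⁻¹ * ∫⁻ t, Φ t * (sqConv (volume.withDensity G))^[n] (sqDensity G) (s - t) := by
  induction n generalizing s with
  | zero => exact sqConv_eq hG hΦ s
  | succ n ih =>
    have hu := measurable_sqConv_iterate (volume.withDensity G) (measurable_sqDensity hG) n
    rw [Function.iterate_succ_apply', sqConv]
    simp_rw [ih]
    have hm : Measurable fun x : ℝ × ℝ =>
        Φ x.2 * (sqConv (volume.withDensity G))^[n] (sqDensity G) (s - x.1 ^ 2 - x.2) := by fun_prop
    rw [lintegral_const_mul _ hm.lintegral_prod_right', lintegral_lintegral_swap hm.aemeasurable]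
    congr 1
    refine lintegral_congr fun t => ?_
    simp only
    rw [lintegral_const_mul _ (by fun_prop), Function.iterate_succ_apply', sqConv]
    simp only [sub_right_comm s t]

/-- In graph coordinates the two sheets of a product density contribute `∏ G (w j)` times
`sqDensity` of the missing energy `n + 1 - |w|²`. -/
theorem partitionFn_eq {g : ℝ → ℝ} (hg : Measurable g)
    [SigmaFinite (volume.withDensity fun v => ENNReal.ofReal (g v))] (n : ℕ) :
    partitionFn g (n + 1) = sheetConst n *
      (sqConv (volume.withDensity fun v => ENNReal.ofReal (g v)))^[n]
        (sqDensity fun v => ENNReal.ofReal (g v)) (n + 1 : ℕ) := by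
  have hG : Measurable fun v => ENNReal.ofReal (g v) := hg.ennreal_ofReal
  have hf := measurable_sqDensity hG
  rw [partitionFn, lintegral_uniformSphere 0 (F := fun v => ∏ j, ENNReal.ofReal (g (v j)))
    (by fun_prop), sqConv_iterate_eq _ hf, lintegral_pi_withDensity hG (by fun_prop)]
  congr 1
  refine lintegral_congr fun w => ?_
  simp only [sheetSum, sqDensity, Fin.prod_univ_succ, Fin.insertNth_zero', Fin.cons_zero,
    Fin.cons_succ]
  ring

/-- Up to a constant, the density of a sum of `n + 1` independent copies of `v ^ 2`, where `v` has
density `G`. -/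
noncomputable def sumDensity (G : ℝ → ℝ≥0∞) (n : ℕ) : ℝ → ℝ≥0∞ :=
  (sqConv (volume.withDensity G))^[n] (sqDensity G)

theorem measurable_sumDensity {G : ℝ → ℝ≥0∞} (hG : Measurable G)
    [SFinite (volume.withDensity G)] (n : ℕ) : Measurable (sumDensity G n) :=
  measurable_sqConv_iterate _ (measurable_sqDensity hG) n

theorem sumDensity_add (G : ℝ → ℝ≥0∞) (m n : ℕ) :
    sumDensity G (m + n) = (sqConv (volume.withDensity G))^[m] (sumDensity G n) :=
  Function.iterate_add_apply _ _ _ _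

/-! ### Subexponential lower bound for the density at the mean. -/

/-- `u` is at least `c` on the interval of radius `r` around `a`. -/
def LowerOn (u : ℝ → ℝ≥0∞) (c : ℝ≥0∞) (a r : ℝ) : Prop := ∀ s, |s - a| ≤ r → c ≤ u s

/-- Asking for only an overlap of length `r' / 2` in the convolution lets the radius grow by `r' /
2`. The index of `sumDensity` is one less than the number of summands, hence `m + n + 1`. -/
theorem LowerOn.conv {G : ℝ → ℝ≥0∞} (hG : Measurable G)
    {m n : ℕ} {c c' : ℝ≥0∞} {a a' r r' : ℝ}
    (h : LowerOn (sumDensity G m) c a r) (h' : LowerOn (sumDensity G n) c' a' r') (hr' : 0 ≤ r') (hr : r' / 4 ≤ r) :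
    LowerOn (sumDensity G (m + n + 1)) (2⁻¹ * (c * c' * ENNReal.ofReal (r' / 2))) (a + a') (r + r' / 2) := by
  intro s hs
  have hu := measurable_sumDensity hG m
  rw [show m + n + 1 = n + 1 + m by omega, sumDensity_add, sqConv_iterate_succ_eq hG hu]
  gcongr
  set d := s - (a + a') with hd
  -- The displacement `d` is truncated so that the interval of radius `r' / 4` around `a + e` stays
  -- within `r` of `a`; the excess `|d - e| ≤ 3 r' / 4` is left to the second factor.
  set e := max (-(r - r' / 4)) (min d (r - r' / 4)) with he
  have hd' := abs_le.1 hs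
  have he1 : -(r - r' / 4) ≤ e := le_max_left _ _
  have he2 : e ≤ r - r' / 4 := max_le (by linarith) (min_le_right _ _)
  have he3 : d - 3 * r' / 4 ≤ e := by
    refine le_max_of_le_right (le_min (by linarith) (by linarith))
  have he4 : e ≤ d + 3 * r' / 4 := max_le (by linarith) ((min_le_left _ _).trans (by linarith))
  set J := Set.Icc (a + e - r' / 4) (a + e + r' / 4)
  calc c * c' * ENNReal.ofReal (r' / 2) = ∫⁻ _ in J, c * c' := by
        rw [setLIntegral_const, Real.volume_Icc]
        congr 2
        ring
    _ ≤ ∫⁻ t in J, sumDensity G m t * sumDensity G n (s - t) := by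
        refine setLIntegral_mono' measurableSet_Icc fun t ht => ?_
        refine mul_le_mul' (h t (abs_le.2 ⟨?_, ?_⟩)) (h' _ (abs_le.2 ⟨?_, ?_⟩)) <;>
          linarith [ht.1, ht.2]
    _ ≤ _ := setLIntegral_le_lintegral _ _

/-- Here `n + 1` groups of `k + 1` summands are added. The radius grows linearly in `n`, which beats
fluctuations of order square root, at a fixed factor per group. -/
theorem LowerOn.iterate {G : ℝ → ℝ≥0∞} (hG : Measurable G)
    {k : ℕ} {c : ℝ≥0∞} {a r : ℝ} (h : LowerOn (sumDensity G k) c a r) (hr : 0 ≤ r)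
    (n : ℕ) :
    LowerOn (sumDensity G (n * (k + 1) + k)) (c * (2⁻¹ * (c * ENNReal.ofReal (r / 2))) ^ n) ((n + 1) * a)
      (r + n * (r / 2)) := by
  induction n with
  | zero => simpa using h
  | succ n ih =>
    have := LowerOn.conv hG ih h hr (by nlinarith [(Nat.cast_nonneg n : (0 : ℝ) ≤ n)])
    have e1 : n * (k + 1) + k + k + 1 = (n + 1) * (k + 1) + k := by ring
    rw [e1] at this
    convert this using 1
    · ring
    · push_cast
      ring
    · push_cast
      ring

/-- Condition each of `l` further summands to lie within `δ` of `b`: every one moves the centre by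
`b`, and costs `δ` of radius and the probability of the event. -/
theorem LowerOn.shift {G : ℝ → ℝ≥0∞} {n : ℕ} {c : ℝ≥0∞} {a r : ℝ} (h : LowerOn (sumDensity G n) c a r) (b δ : ℝ) (l : ℕ) :
    LowerOn (sumDensity G (n + l)) (c * volume.withDensity G {v | |v ^ 2 - b| ≤ δ} ^ l) (a + l * b)
      (r - l * δ) := by
  induction l with
  | zero => simpa using h
  | succ l ih =>
    intro s hs
    rw [← add_assoc, add_comm (n + l) 1, sumDensity_add, Function.iterate_one, sqConv, pow_succ, ← mul_assoc, ← setLIntegral_const]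
    have hS : MeasurableSet {v : ℝ | |v ^ 2 - b| ≤ δ} :=
      measurableSet_le (by fun_prop) measurable_const
    refine le_trans (setLIntegral_mono' hS fun v hv => ?_) (setLIntegral_le_lintegral _ _)
    refine ih _ ?_
    have h1 := abs_le.1 hs
    have h2 := abs_le.1 (show |v ^ 2 - b| ≤ δ from hv)
    push_cast at h1
    exact abs_le.2 ⟨by linarith [h1.1, h2.1], by linarith [h1.2, h2.2]⟩

/-- Near twice a Lebesgue density point of a set, translates of its reflection meet the set in
uniformly large measure. -/
theorem exists_le_volume_inter_sub_preimage {E : Set ℝ} (hE : MeasurableSet E)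
    (h0 : volume E ≠ 0) :
    ∃ a r : ℝ, 0 < r ∧ ∀ s, |s - 2 * a| ≤ r / 4 →
      ENNReal.ofReal (r / 2) ≤ volume (E ∩ (fun t => s - t) ⁻¹' E) := by
  have hne : (ae (volume.restrict E)).NeBot := by
    rw [ae_neBot]
    simpa using h0
  obtain ⟨a, ha⟩ := (Besicovitch.ae_tendsto_measure_inter_div volume E).exists
  have hlt : ENNReal.ofReal (3 / 4) < 1 := by
    rw [ENNReal.ofReal_lt_one]
    norm_num
  obtain ⟨r, hr1, hr0⟩ := ((ha.eventually_const_lt hlt).and self_mem_nhdsWithin).exists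
  have hr : 0 < r := hr0
  refine ⟨a, r, hr, fun s hs => ?_⟩
  -- `A` has measure at least `3 r / 2`, as does its reflection `B`, while both lie in a ball of
  -- measure `5 r / 2`; so they overlap in measure at least `r / 2`.
  set A := E ∩ Metric.closedBall a r with hA
  have hAm : MeasurableSet A := hE.inter Metric.isClosed_closedBall.measurableSet
  have hAvol : ENNReal.ofReal (3 / 2 * r) ≤ volume A := by
    rw [Real.volume_closedBall, ENNReal.lt_div_iff_mul_lt (by simp [hr]) (by simp),
      ← ENNReal.ofReal_mul (by norm_num)] at hr1
    refine le_trans (le_of_eq ?_) hr1.le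
    congr 1
    ring
  set B := (fun t => s - t) ⁻¹' A with hB
  have hBm : MeasurableSet B := hAm.preimage (by fun_prop)
  have hBvol : volume B = volume A := (Measure.measurePreserving_sub_left volume s).measure_preimage
    hAm.nullMeasurableSet
  have hunion : volume (A ∪ B) ≤ ENNReal.ofReal (5 / 2 * r) := by
    have : A ∪ B ⊆ Metric.closedBall a (5 / 4 * r) := by
      rintro t (ht | ht)
      · exact Metric.closedBall_subset_closedBall (by linarith) ht.2
      · have h1 : |s - t - a| ≤ r := ht.2
        have h2 := abs_le.1 h1
        have h3 := abs_le.1 hs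
        rw [Metric.mem_closedBall, Real.dist_eq]
        exact abs_le.2 ⟨by linarith [h2.2, h3.1], by linarith [h2.1, h3.2]⟩
    refine (measure_mono this).trans (le_of_eq ?_)
    rw [Real.volume_closedBall]
    congr 1
    ring
  have hsum := measure_union_add_inter (μ := volume) A hBm
  have hinter : volume (A ∩ B) ≤ volume (E ∩ (fun t => s - t) ⁻¹' E) :=
    measure_mono (Set.inter_subset_inter Set.inter_subset_left
      (Set.preimage_mono Set.inter_subset_left))
  refine le_trans ?_ hinter
  have h1 : ENNReal.ofReal (5 / 2 * r) + ENNReal.ofReal (r / 2) ≤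
      ENNReal.ofReal (5 / 2 * r) + volume (A ∩ B) := by
    calc _ = ENNReal.ofReal (3 / 2 * r) + ENNReal.ofReal (3 / 2 * r) := by
          rw [← ENNReal.ofReal_add (by positivity) (by positivity),
            ← ENNReal.ofReal_add (by positivity) (by positivity)]
          congr 1
          ring
      _ ≤ volume A + volume B := by
          rw [hBvol]
          gcongr
      _ = volume (A ∪ B) + volume (A ∩ B) := hsum.symm
      _ ≤ _ := by gcongr
  exact (ENNReal.add_le_add_iff_left ENNReal.ofReal_ne_top).1 h1

/-- One density is bounded below only on a set of positive measure, which need not contain an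
interval; two summands suffice by a Steinhaus argument. -/
theorem exists_lowerOn_one {G : ℝ → ℝ≥0∞} (hG : Measurable G)
    [IsProbabilityMeasure (volume.withDensity G)] :
    ∃ (c : ℝ≥0∞) (a r : ℝ), c ≠ 0 ∧ 0 < r ∧ LowerOn (sumDensity G 1) c a r := by
  have hf := measurable_sqDensity hG
  have hint : ∫⁻ t, sqDensity G t ≠ 0 := by
    intro h
    have := lintegral_sq_withDensity hG (Φ := fun _ => 1) measurable_const
    simp [h] at this
  obtain ⟨n, hn⟩ : ∃ n : ℕ, volume {t | ((n : ℝ≥0∞) + 1)⁻¹ ≤ sqDensity G t} ≠ 0 := by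
    by_contra! hcon
    refine hint ((lintegral_eq_zero_iff hf).2 (measure_mono_null (t := ⋃ n : ℕ,
      {t | ((n : ℝ≥0∞) + 1)⁻¹ ≤ sqDensity G t}) ?_ (measure_iUnion_null hcon)))
    intro t ht
    obtain ⟨n, hn⟩ := ENNReal.exists_inv_nat_lt (a := sqDensity G t) ht
    exact Set.mem_iUnion.2 ⟨n, (ENNReal.inv_le_inv.2 le_self_add).trans hn.le⟩
  set c : ℝ≥0∞ := ((n : ℝ≥0∞) + 1)⁻¹
  have hc : c ≠ 0 := ENNReal.inv_ne_zero.2 (by simp)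
  set E := {t | c ≤ sqDensity G t}
  have hE : MeasurableSet E := measurableSet_le measurable_const hf
  obtain ⟨a, r, hr, har⟩ := exists_le_volume_inter_sub_preimage hE hn
  refine ⟨2⁻¹ * (c * c * ENNReal.ofReal (r / 2)), 2 * a, r / 4, ?_, by positivity, fun s hs => ?_⟩
  · have : ENNReal.ofReal (r / 2) ≠ 0 := by simpa using hr
    simp [hc, hr]
  · have h1 : sumDensity G 1 s = 2⁻¹ * ∫⁻ t, sqDensity G t * sqDensity G (s - t) :=
      sqConv_iterate_succ_eq hG hf 0 s
    rw [h1]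
    gcongr
    have hEm : MeasurableSet (E ∩ (fun t => s - t) ⁻¹' E) := hE.inter (hE.preimage (by fun_prop))
    calc c * c * ENNReal.ofReal (r / 2) ≤ c * c * volume (E ∩ (fun t => s - t) ⁻¹' E) := by
          gcongr
          exact har s hs
      _ = ∫⁻ _ in E ∩ (fun t => s - t) ⁻¹' E, c * c := (setLIntegral_const _ _).symm
      _ ≤ ∫⁻ t in E ∩ (fun t => s - t) ⁻¹' E, sqDensity G t * sqDensity G (s - t) :=
          setLIntegral_mono' hEm fun t ht => mul_le_mul' ht.1 ht.2
      _ ≤ _ := setLIntegral_le_lintegral _ _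

theorem exists_forall_measure_abs_sq_sub_le_pos {m : Measure ℝ} {O : Set ℝ} (hO : IsOpen O)
    (h : m {v | v ^ 2 ∈ O} ≠ 0) :
    ∃ b ∈ O, ∀ δ > 0, m {v | |v ^ 2 - b| ≤ δ} ≠ 0 := by
  have hsq : Measurable fun v : ℝ => v ^ 2 := by fun_prop
  have h' : m.map (fun v => v ^ 2) O ≠ 0 := by rwa [Measure.map_apply hsq hO.measurableSet]
  obtain ⟨b, hb, hpos⟩ := exists_mem_forall_mem_nhdsWithin_pos_measure h'
  refine ⟨b, hb, fun δ hδ => ?_⟩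
  have := hpos (Metric.closedBall b δ) (mem_nhdsWithin_of_mem_nhds (Metric.closedBall_mem_nhds b hδ))
  rw [Measure.map_apply hsq Metric.isClosed_closedBall.measurableSet] at this
  exact this.ne'

theorem measure_sq_eq_one {G : ℝ → ℝ≥0∞} : volume.withDensity G {v | v ^ 2 = 1} = 0 := by
  refine withDensity_absolutelyContinuous _ _ ?_
  have : {v : ℝ | v ^ 2 = 1} = {1, -1} := by
    ext v
    simp [pow_two, mul_self_eq_one_iff]
  rw [this]
  exact (Set.toFinite _).measure_zero _

/-- If `v ^ 2` has mean one under an absolutely continuous law, it charges both sides of one. -/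
theorem measure_mul_sq_sub_one_pos_ne_zero {G : ℝ → ℝ≥0∞} [IsProbabilityMeasure (volume.withDensity G)]
    (hi : Integrable (fun v => v ^ 2) (volume.withDensity G))
    (h1 : ∫ v, v ^ 2 ∂(volume.withDensity G) = 1) (ε : ℝ) (hε : ε ≠ 0) :
    volume.withDensity G {v | 0 < ε * (v ^ 2 - 1)} ≠ 0 := by
  intro h
  have hae : ∀ᵐ v ∂(volume.withDensity G), 0 ≤ -(ε * (v ^ 2 - 1)) := by
    filter_upwards [measure_eq_zero_iff_ae_notMem.1 h] with v hv
    linarith [not_lt.1 hv]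
  have hint : ∫ v, -(ε * (v ^ 2 - 1)) ∂(volume.withDensity G) = 0 := by
    rw [integral_neg, integral_const_mul, integral_sub hi (integrable_const _), h1]
    simp
  have hz := (integral_eq_zero_iff_of_nonneg_ae hae
    ((hi.sub (integrable_const _)).const_mul ε).neg).1 hint
  have hone : ∀ᵐ v ∂(volume.withDensity G), v ∈ {v : ℝ | v ^ 2 = 1} := by
    filter_upwards [hz] with v hv
    have : ε * (v ^ 2 - 1) = 0 := by simpa using hv
    rcases mul_eq_zero.1 this with h | h
    · exact absurd h hε
    · exact sub_eq_zero.1 h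
  have h2 := measure_sq_eq_one (G := G)
  rw [measure_eq_zero_iff_ae_notMem] at h2
  obtain ⟨v, hv1, hv2⟩ := (hone.and h2).exists
  exact hv2 hv1

/-- The interval from `exists_lowerOn_one` has an arbitrary centre. Since `v²` charges
neighbourhoods of some `b < 1` and some `b' > 1`, extra summands can move the centre up or down
relative to the mean. -/
theorem exists_lowerOn_mean {G : ℝ → ℝ≥0∞} (hG : Measurable G)
    [IsProbabilityMeasure (volume.withDensity G)]
    (hi : Integrable (fun v => v ^ 2) (volume.withDensity G))
    (h1 : ∫ v, v ^ 2 ∂(volume.withDensity G) = 1) :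
    ∃ (k : ℕ) (c : ℝ≥0∞) (r : ℝ), c ≠ 0 ∧ 0 < r ∧ LowerOn (sumDensity G k) c (k + 1) r := by
  obtain ⟨c, a, η, hc, hη, hlow⟩ := exists_lowerOn_one hG
  obtain ⟨b, hb, hbpos⟩ := exists_forall_measure_abs_sq_sub_le_pos (m := volume.withDensity G)
    (isOpen_Iio (a := (1 : ℝ))) (by
      have := measure_mul_sq_sub_one_pos_ne_zero hi h1 (-1) (by norm_num)
      convert this using 3
      ext v
      simp)
  obtain ⟨b', hb', hbpos'⟩ := exists_forall_measure_abs_sq_sub_le_pos (m := volume.withDensity G)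
    (isOpen_Ioi (a := (1 : ℝ))) (by
      have := measure_mul_sq_sub_one_pos_ne_zero hi h1 1 (by norm_num)
      convert this using 3
      ext v
      simp)
  have hα : 0 < 1 - b := sub_pos.2 hb
  have hβ : 0 < b' - 1 := sub_pos.2 hb'
  -- Enough groups are added for the gain in radius, `n η / 2`, to exceed the step `1 - b` of the
  -- final adjustment.
  obtain ⟨n, hn⟩ := exists_nat_ge ((1 - b) / (η / 2))
  rw [div_le_iff₀ (by positivity)] at hn
  obtain ⟨l, hl⟩ := exists_nat_ge (-((n + 1) * (a - 2)) / (b' - 1))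
  rw [div_le_iff₀ hβ] at hl
  -- The excess of the centre over the mean, each group of two having mean `2`. The `l` summands
  -- near `b'` make it nonnegative; `j` summands near `b` then bring it into `[0, 1 - b)`.
  set y := (n + 1) * (a - 2) + l * (b' - 1) with hy
  have hy0 : 0 ≤ y := by linarith
  set j := ⌊y / (1 - b)⌋₊ with hj
  have hj1 : j * (1 - b) ≤ y := by
    rw [← le_div_iff₀ hα]
    exact Nat.floor_le (by positivity)
  have hj2 : y < (j + 1) * (1 - b) := by
    rw [← div_lt_iff₀ hα]
    exact Nat.lt_floor_add_one _
  -- All `l + j` shifts together lose at most `η / 4` of radius, which leaves room for the radius `η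
  -- / 2` claimed.
  set δ := η / (4 * (l + j + 1)) with hδ
  have hδ0 : 0 < δ := by positivity
  have hδle : (l + j) * δ ≤ η / 4 := by
    rw [hδ, mul_div_assoc', div_le_div_iff₀ (by positivity) (by positivity)]
    nlinarith
  have h3 := ((LowerOn.iterate hG hlow hη.le n).shift b' δ l).shift b δ j
  refine ⟨_, _, η / 2, ?_, by positivity, fun s hs => h3 s ?_⟩
  · have : ENNReal.ofReal (η / 2) ≠ 0 := by simpa using hη
    refine mul_ne_zero (mul_ne_zero (mul_ne_zero hc (pow_ne_zero _ (mul_ne_zero (by simp)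
      (mul_ne_zero hc this)))) (pow_ne_zero _ (hbpos' δ hδ0))) (pow_ne_zero _ (hbpos δ hδ0))
  · push_cast at hs
    have h4 := abs_le.1 hs
    refine abs_le.2 ⟨?_, ?_⟩ <;> nlinarith [h4.1, h4.2]

theorem half_le_pi_abs_sum_sq_sub_le {m : Measure ℝ} [IsProbabilityMeasure m]
    (h4 : MemLp (fun v => v ^ 2) 2 m) (h1 : ∫ v, v ^ 2 ∂m = 1) {M : ℕ} {ρ : ℝ} (hρ : 0 < ρ)
    (hM : 2 * (M * Var[fun v => v ^ 2; m]) ≤ ρ ^ 2) :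
    2⁻¹ ≤ Measure.pi (fun _ : Fin M => m) {w | |∑ i, w i ^ 2 - M| ≤ ρ} := by
  set P := Measure.pi (fun _ : Fin M => m)
  set X : (Fin M → ℝ) → ℝ := ∑ i, fun w => w i ^ 2 with hX
  have hmem : ∀ i : Fin M, MemLp (fun w : Fin M → ℝ => w i ^ 2) 2 P := fun i =>
    h4.comp_measurePreserving (measurePreserving_eval _ i)
  have hXmem : MemLp X 2 P := memLp_finsetSum' _ fun i _ => hmem i
  have hXap : ∀ w, X w = ∑ i, w i ^ 2 := fun w => by simp [hX]
  have hmean : ∫ w, X w ∂P = (M : ℝ) := by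
    simp only [hXap]
    rw [integral_finsetSum _ fun i _ => (hmem i).integrable one_le_two]
    have : ∀ i : Fin M, ∫ w, w i ^ 2 ∂P = 1 := fun i => by
      rw [← h1]
      exact integral_comp_eval (μ := fun _ : Fin M => m) (i := i) (f := fun v => v ^ 2)
        h4.aestronglyMeasurable
    simp [this]
  have hvar : Var[X; P] = M * Var[fun v => v ^ 2; m] := by
    rw [hX, variance_sum_pi (X := fun _ v => v ^ 2) fun _ => h4]
    simp
  have hcheb := meas_ge_le_variance_div_sq hXmem hρ
  rw [hmean, hvar] at hcheb
  have hle : P {w | ρ ≤ |X w - M|} ≤ 2⁻¹ := by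
    refine hcheb.trans ?_
    rw [← ENNReal.ofReal_ofNat, ← ENNReal.ofReal_inv_of_pos two_pos]
    refine ENNReal.ofReal_le_ofReal ?_
    rw [div_le_iff₀ (by positivity)]
    linarith
  have hms : MeasurableSet {w : Fin M → ℝ | |∑ i, w i ^ 2 - M| ≤ ρ} :=
    measurableSet_le (by fun_prop) measurable_const
  have hcompl : P {w | |∑ i, w i ^ 2 - M| ≤ ρ}ᶜ ≤ 2⁻¹ := by
    refine (measure_mono fun w hw => ?_).trans hle
    have hw' : ¬ |∑ i, w i ^ 2 - M| ≤ ρ := hw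
    change ρ ≤ |X w - M|
    rw [hXap]
    exact (not_le.1 hw').le
  have hadd := measure_add_measure_compl (μ := P) hms
  rw [measure_univ, ← ENNReal.inv_two_add_inv_two] at hadd
  by_contra hlt
  have hlt' := not_le.1 hlt
  have := ENNReal.add_lt_add_of_lt_of_le (by simp) hlt' hcompl
  exact this.ne hadd

/-- The density at its mean of a sum of iid copies of `v ^ 2` is not exponentially small. -/
theorem eventually_exp_le_sumDensity {G : ℝ → ℝ≥0∞} (hG : Measurable G)
    [IsProbabilityMeasure (volume.withDensity G)]
    (h4 : MemLp (fun v => v ^ 2) 2 (volume.withDensity G))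
    (h1 : ∫ v, v ^ 2 ∂(volume.withDensity G) = 1) {ε : ℝ} (hε : 0 < ε) :
    ∀ᶠ n : ℕ in atTop, ENNReal.ofReal (Real.exp (-(ε * n))) ≤ sumDensity G n (n + 1 : ℕ) := by
  obtain ⟨k, c₀, r, hc₀, hr, hlow₀⟩ :=
    exists_lowerOn_mean hG (h4.integrable one_le_two) h1
  set V := Var[fun v => v ^ 2; volume.withDensity G] with hV
  have hV0 : 0 ≤ V := variance_nonneg _ _
  -- Truncation makes the constant finite, so its logarithm can be taken.
  set c := min c₀ 1
  have hc : c ≠ 0 := (lt_min (pos_iff_ne_zero.2 hc₀) one_pos).ne'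
  have hct : c ≠ ∞ := ne_top_of_le_ne_top ENNReal.one_ne_top (min_le_right _ _)
  have hlow : LowerOn (sumDensity G k) c (k + 1) r := fun s hs => (min_le_left _ _).trans (hlow₀ s hs)
  have hiter := LowerOn.iterate hG hlow hr.le
  set c₁ : ℝ≥0∞ := 2⁻¹ * (c * ENNReal.ofReal (r / 2)) with hc₁
  have hc₁0 : c₁ ≠ 0 := mul_ne_zero (by simp) (mul_ne_zero hc (by simpa using hr))
  have hc₁t : c₁ ≠ ∞ := ENNReal.mul_ne_top (by simp) (ENNReal.mul_ne_top hct ENNReal.ofReal_ne_top)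
  set L := |Real.log c₁.toReal| with hL
  have hc₁L : ENNReal.ofReal (Real.exp (-L)) ≤ c₁ := by
    rw [← ENNReal.ofReal_toReal hc₁t]
    refine ENNReal.ofReal_le_ofReal ?_
    rw [← Real.exp_log (ENNReal.toReal_pos hc₁0 hc₁t)]
    exact Real.exp_le_exp.2 (neg_abs_le _)
  set D := |Real.log c.toReal| with hD
  have hcD : ENNReal.ofReal (Real.exp (-D)) ≤ c := by
    rw [← ENNReal.ofReal_toReal hct]
    refine ENNReal.ofReal_le_ofReal ?_
    rw [← Real.exp_log (ENNReal.toReal_pos hc hct)]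
    exact Real.exp_le_exp.2 (neg_abs_le _)
  have hL0 : 0 ≤ L := abs_nonneg _
  -- The number of groups per summand. The first bound keeps their cost above `exp (-ε n / 2)`; the
  -- second makes `θ n` groups use at most half of the summands.
  set θ := min (ε / (2 * (L + 1))) (1 / (2 * (k + 1))) with hθ
  have hθ0 : 0 < θ := lt_min (by positivity) (by positivity)
  have hθ1 : θ * L ≤ ε / 2 := by
    calc θ * L ≤ ε / (2 * (L + 1)) * (L + 1) := by
          gcongr
          · exact min_le_left _ _
          · linarith
      _ = ε / 2 := by field_simp
  have hθ2 : θ * (k + 1) ≤ 1 / 2 := by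
    calc θ * (k + 1) ≤ 1 / (2 * (k + 1)) * (k + 1) := by
          gcongr
          exact min_le_right _ _
      _ = 1 / 2 := by field_simp
  have hlarge : ∀ᶠ n : ℕ in atTop, 2 * (k + 1) ≤ (n : ℝ) ∧ 2 * (D + Real.log 2) / ε ≤ n ∧
      1 ≤ θ * n ∧ 2 * (n + 1) * V ≤ (θ * n * (r / 4)) ^ 2 := by
    have t := tendsto_natCast_atTop_atTop (R := ℝ)
    refine (t.eventually_ge_atTop _).and ((t.eventually_ge_atTop _).and ?_)
    filter_upwards [t.eventually_ge_atTop (1 / θ), t.eventually_ge_atTop 1,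
      t.eventually_ge_atTop (4 * V / (θ * (r / 4)) ^ 2)] with n ha hb hd
    refine ⟨by rwa [div_le_iff₀' hθ0] at ha, ?_⟩
    rw [div_le_iff₀ (by positivity)] at hd
    calc 2 * (n + 1) * V ≤ 2 * (n + n) * V := by gcongr
      _ = n * (4 * V) := by ring
      _ ≤ n * (n * (θ * (r / 4)) ^ 2) := by gcongr
      _ = _ := by ring
  filter_upwards [hlarge] with n ⟨hn1, hn2, hn3, hn4⟩
  set j := ⌊θ * n⌋₊ with hj
  have hj1 : (j : ℝ) ≤ θ * n := Nat.floor_le (by positivity)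
  have hj2 : θ * n < j + 1 := Nat.lt_floor_add_one _
  have hj3 : θ * n ≤ 2 * j := by
    have : (1 : ℝ) ≤ j := by exact_mod_cast Nat.le_floor (by simpa using hn3)
    linarith
  have hjn : j * (k + 1) + k ≤ n := by
    have : (j : ℝ) * (k + 1) + k ≤ n := by
      have : (j : ℝ) * (k + 1) ≤ n / 2 := by
        calc (j : ℝ) * (k + 1) ≤ θ * n * (k + 1) := by gcongr
          _ = n * (θ * (k + 1)) := by ring
          _ ≤ n * (1 / 2) := by gcongr
          _ = n / 2 := by ring
      linarith
    exact_mod_cast this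
  obtain ⟨M, hM⟩ := Nat.exists_eq_add_of_le' hjn
  have hMn : (n : ℝ) = M + (j * (k + 1) + k) := by rw [hM]; push_cast; ring
  have hρ : 0 < j * (r / 2) := by
    have : 0 < θ * n := by linarith
    have : (0 : ℝ) < j := by linarith
    positivity
  have hcheb := half_le_pi_abs_sum_sq_sub_le h4 h1 (M := M) hρ (by
    rw [← hV]
    have hMle : (M : ℝ) ≤ n + 1 := by
      rw [hMn]
      have : (0 : ℝ) ≤ j * (k + 1) := by positivity
      linarith
    calc 2 * (M * V) ≤ 2 * ((n + 1) * V) := by gcongr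
      _ = 2 * (n + 1) * V := by ring
      _ ≤ (θ * n * (r / 4)) ^ 2 := hn4
      _ ≤ (2 * j * (r / 4)) ^ 2 := by gcongr
      _ = _ := by ring)
  have hS : MeasurableSet {w : Fin M → ℝ | |∑ i, w i ^ 2 - M| ≤ j * (r / 2)} :=
    measurableSet_le (by fun_prop) measurable_const
  -- The `n + 1` summands split into `M` free ones and `j + 1` groups of `k + 1`. Once the free sum
  -- is within `j r / 2` of its mean `M`, the groups' density is evaluated inside its interval of
  -- radius `r + j r / 2`.
  have hmain : c * c₁ ^ j * 2⁻¹ ≤ sumDensity G n (n + 1 : ℕ) := by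
    conv_rhs => rw [hM, sumDensity_add, sqConv_iterate_eq _ (measurable_sumDensity hG _)]
    calc c * c₁ ^ j * 2⁻¹ ≤ c * c₁ ^ j * Measure.pi (fun _ : Fin M => volume.withDensity G)
          {w | |∑ i, w i ^ 2 - M| ≤ j * (r / 2)} := by gcongr
      _ = ∫⁻ _ in {w : Fin M → ℝ | |∑ i, w i ^ 2 - M| ≤ j * (r / 2)}, c * c₁ ^ j
          ∂Measure.pi (fun _ : Fin M => volume.withDensity G) := (setLIntegral_const _ _).symm
      _ ≤ _ := by
          refine le_trans (setLIntegral_mono' hS fun w hw => ?_) (setLIntegral_le_lintegral _ _)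
          refine hiter j _ ?_
          have h5 := abs_le.1 (show |∑ i, w i ^ 2 - M| ≤ j * (r / 2) from hw)
          push_cast
          refine abs_le.2 ⟨?_, ?_⟩ <;> nlinarith [h5.1, h5.2]
  refine le_trans ?_ hmain
  calc ENNReal.ofReal (Real.exp (-(ε * n)))
      ≤ ENNReal.ofReal (Real.exp (-D) * Real.exp (-L) ^ j * 2⁻¹) := by
        refine ENNReal.ofReal_le_ofReal ?_
        rw [← Real.exp_nat_mul, ← Real.exp_add, ← Real.exp_log (show (0 : ℝ) < 2⁻¹ by norm_num),
          ← Real.exp_add, Real.log_inv]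
        refine Real.exp_le_exp.2 ?_
        rw [div_le_iff₀ hε] at hn2
        have : (j : ℝ) * L ≤ ε / 2 * n := by
          calc (j : ℝ) * L ≤ θ * n * L := by gcongr
            _ = θ * L * n := by ring
            _ ≤ _ := by gcongr
        linarith
    _ = ENNReal.ofReal (Real.exp (-D)) * ENNReal.ofReal (Real.exp (-L)) ^ j * 2⁻¹ := by
        rw [ENNReal.ofReal_mul (by positivity), ENNReal.ofReal_mul (by positivity),
          ENNReal.ofReal_pow (by positivity), ENNReal.ofReal_inv_of_pos two_pos,
          ENNReal.ofReal_ofNat]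
    _ ≤ _ := by gcongr

/-! ### Entropy inequality and exponential moments of independent blocks. -/

/-- The entropy inequality of Donsker and Varadhan. -/
theorem integral_le_klDiv_add_log_integral_exp {α : Type*} [MeasurableSpace α] {μ π : Measure α}
    [IsProbabilityMeasure μ] [IsProbabilityMeasure π] (h : InformationTheory.klDiv μ π ≠ ∞)
    {F : α → ℝ} (hF : Measurable F) {B : ℝ} (hB : ∀ x, |F x| ≤ B) :
    ∫ x, F x ∂μ ≤ (InformationTheory.klDiv μ π).toReal + Real.log (∫ x, Real.exp (F x) ∂π) := by
  obtain ⟨hac, hint⟩ := InformationTheory.klDiv_ne_top_iff.1 h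
  have hFμ : Integrable F μ := Integrable.of_bound hF.aestronglyMeasurable B (ae_of_all _ hB)
  have hFπ : Integrable (fun x => Real.exp (F x)) π :=
    Integrable.of_bound (by fun_prop) (Real.exp B) (ae_of_all _ fun x => by
      rw [Real.norm_eq_abs, Real.abs_exp]
      exact Real.exp_le_exp.2 ((le_abs_self _).trans (hB x)))
  -- The inequality is the nonnegativity of the entropy of `μ` relative to `π` tilted by `F`, with
  -- the log-likelihood ratio expanded.
  have : IsProbabilityMeasure (π.tilted F) := isProbabilityMeasure_tilted hFπ
  have hac' : μ ≪ π.tilted F := hac.trans (absolutelyContinuous_tilted hFπ)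
  have h1 := InformationTheory.integral_llr_add_sub_measure_univ_nonneg hac'
    (integrable_llr_tilted_right hac hFμ hint hFπ)
  rw [integral_llr_tilted_right hac hFμ hFπ hint] at h1
  rw [InformationTheory.toReal_klDiv_of_measure_eq hac (by simp)]
  simp only [probReal_univ] at h1
  linarith

/-- Grouping the coordinates of a product measure into disjoint blocks. -/
theorem map_blocks_pi {m : Measure ℝ} [IsProbabilityMeasure m] {L k N : ℕ}
    {e : Fin L × Fin k → Fin N} (he : Function.Injective e) :
    (Measure.pi fun _ : Fin N => m).map (fun y b i => y (e (b, i))) =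
      Measure.pi fun _ : Fin L => Measure.pi fun _ : Fin k => m := by
  have hind : iIndepFun (fun (p : Fin L × Fin k) (y : Fin N → ℝ) => y (e p))
      (Measure.pi fun _ : Fin N => m) :=
    (iIndepFun_pi (X := fun _ v => v) fun _ => aemeasurable_id).precomp he
  have hlaw := (iIndepFun_iff_map_fun_eq_pi_map fun p => (measurable_pi_apply (e p)).aemeasurable).1
    hind
  have heval : ∀ p, (Measure.pi fun _ : Fin N => m).map (fun y => y (e p)) = m := fun p =>
    (measurePreserving_eval (fun _ : Fin N => m) (e p)).map_eq
  simp only [heval] at hlaw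
  have hc : Measurable fun (z : Fin L × Fin k → ℝ) b i => z (b, i) := by fun_prop
  have hcomp : (fun (y : Fin N → ℝ) b i => y (e (b, i))) =
      (fun (z : Fin L × Fin k → ℝ) b i => z (b, i)) ∘ fun y p => y (e p) := rfl
  rw [hcomp, ← Measure.map_map hc (by fun_prop), hlaw]
  symm
  refine Measure.pi_eq_generateFrom (fun _ => generateFrom_pi) (fun _ => isPiSystem_pi)
    (fun _ => ⟨fun _ => Set.univ, fun _ => ⟨fun _ => Set.univ, fun _ _ => MeasurableSet.univ, by simp⟩,
      fun _ => measure_lt_top _ _, Set.iUnion_const _⟩) ?_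
  intro s hs
  choose t ht hts using hs
  have hpre : (fun (z : Fin L × Fin k → ℝ) b i => z (b, i)) ⁻¹' (Set.univ.pi s) =
      Set.univ.pi fun p => t p.1 p.2 := by
    ext z
    simp only [← hts, Set.mem_preimage, Set.mem_univ_pi, Prod.forall]
  have hsm : ∀ b, MeasurableSet (s b) := fun b => by
    rw [← hts b]
    exact MeasurableSet.univ_pi fun i => ht b i (Set.mem_univ i)
  rw [Measure.map_apply hc (MeasurableSet.univ_pi hsm), hpre, Measure.pi_pi,
    Fintype.prod_prod_type]
  refine Finset.prod_congr rfl fun b _ => ?_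
  rw [← hts b, Measure.pi_pi]

/-- Disjoint blocks are independent, so the exponential moment factorises, and Hoeffding's lemma
bounds each factor. -/
theorem lintegral_exp_blocks_le {m : Measure ℝ} [IsProbabilityMeasure m] {L k N : ℕ}
    {e : Fin L × Fin k → Fin N} (he : Function.Injective e) {φ : (Fin k → ℝ) → ℝ}
    (hφ : Measurable φ) {B : ℝ} (hB : ∀ x, |φ x| ≤ B) (t : ℝ) :
    ∫⁻ y : Fin N → ℝ, ENNReal.ofReal (Real.exp (t * ∑ b, (φ (fun i => y (e (b, i))) -
        ∫ x, φ x ∂(Measure.pi fun _ => m)))) ∂(Measure.pi fun _ => m) ≤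
      ENNReal.ofReal (Real.exp (L * (B ^ 2 * t ^ 2 / 2))) := by
  set P := Measure.pi fun _ : Fin k => m
  have hB0 : 0 ≤ B := (abs_nonneg _).trans (hB 0)
  have hsub : HasSubgaussianMGF (fun x => φ x - ∫ x, φ x ∂P) ((‖B - -B‖₊ / 2) ^ 2) P :=
    hasSubgaussianMGF_of_mem_Icc hφ.aemeasurable (ae_of_all _ fun x => abs_le.1 (hB x))
  have hc : (((‖B - -B‖₊ / 2) ^ 2 : NNReal) : ℝ) = B ^ 2 := by
    push_cast
    rw [Real.norm_eq_abs, abs_of_nonneg (by linarith)]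
    ring
  have hone : ∫⁻ x, ENNReal.ofReal (Real.exp (t * (φ x - ∫ x, φ x ∂P))) ∂P ≤
      ENNReal.ofReal (Real.exp (B ^ 2 * t ^ 2 / 2)) := by
    rw [← ofReal_integral_eq_lintegral_ofReal (hsub.integrable_exp_mul t)
      (ae_of_all _ fun _ => (Real.exp_pos _).le)]
    refine ENNReal.ofReal_le_ofReal ?_
    have := hsub.mgf_le t
    rwa [hc] at this
  have hmp : Measurable fun (y : Fin N → ℝ) b i => y (e (b, i)) := by fun_prop
  have hm : ∀ b : Fin L, Measurable fun z : Fin L → Fin k → ℝ =>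
      ENNReal.ofReal (Real.exp (t * (φ (z b) - ∫ x, φ x ∂P))) := fun b => by fun_prop
  calc _ = ∫⁻ z : Fin L → Fin k → ℝ, ∏ b, ENNReal.ofReal (Real.exp (t * (φ (z b) - ∫ x, φ x ∂P)))
        ∂(Measure.pi fun _ => P) := by
        rw [← map_blocks_pi he, lintegral_map (Finset.measurable_prod _ fun b _ => hm b) hmp]
        refine lintegral_congr fun y => ?_
        rw [← ENNReal.ofReal_prod_of_nonneg fun _ _ => (Real.exp_pos _).le, ← Real.exp_sum,
          Finset.mul_sum]
    _ = ∏ b : Fin L, ∫⁻ z : Fin L → Fin k → ℝ,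
          ENNReal.ofReal (Real.exp (t * (φ (z b) - ∫ x, φ x ∂P))) ∂(Measure.pi fun _ => P) := by
        refine lintegral_prod_eq_prod_lintegral_of_indepFun _ _ ?_ hm
        exact iIndepFun_pi (μ := fun _ : Fin L => P)
          (X := fun _ x => ENNReal.ofReal (Real.exp (t * (φ x - ∫ x, φ x ∂P)))) fun _ => by fun_prop
    _ = ∏ b : Fin L, ∫⁻ x, ENNReal.ofReal (Real.exp (t * (φ x - ∫ x, φ x ∂P))) ∂P := by
        refine Finset.prod_congr rfl fun b _ => ?_
        exact (measurePreserving_eval (fun _ : Fin L => P) b).lintegral_comp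
          (f := fun x => ENNReal.ofReal (Real.exp (t * (φ x - ∫ x, φ x ∂P)))) (by fun_prop)
    _ ≤ ∏ b : Fin L, ENNReal.ofReal (Real.exp (B ^ 2 * t ^ 2 / 2)) := by
        gcongr
    _ = _ := by
        rw [Finset.prod_const, Finset.card_univ, Fintype.card_fin,
          ← ENNReal.ofReal_pow (Real.exp_pos _).le, ← Real.exp_nat_mul]

/-! ### Symmetry, and comparison of the conditioned with the plain tensor product. -/

theorem measurable_permute {N : ℕ} (τ : Equiv.Perm (Fin N)) : Measurable (permute τ) := by
  unfold permute
  exact Measurable.subtype_mk (by fun_prop)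

/-- Under a symmetric measure, any `k` distinct coordinates have the law of the first `k`. -/
theorem integral_marginal_eq {k N : ℕ} {μ : ProbabilityMeasure (KacSphere N)}
    (hμ : IsSymmetric (μ : Measure (KacSphere N))) (hk : k ≤ N) {f : Fin k → Fin N}
    (hf : Function.Injective f) {φ : (Fin k → ℝ) → ℝ} (hφ : Measurable φ) :
    ∫ x, φ x ∂(marginal k μ : Measure (Fin k → ℝ)) =
      ∫ v : KacSphere N, φ (fun i => v.1 (f i)) ∂(μ : Measure (KacSphere N)) := by
  obtain ⟨τ, hτ⟩ := Equiv.Perm.exists_extending_pair (Fin.castLE hk) f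
    (Fin.castLE_injective hk) hf
  have hm := measurable_firstCoords k N
  rw [marginal, ProbabilityMeasure.toMeasure_map,
    integral_map hm.aemeasurable hφ.aestronglyMeasurable]
  conv_lhs => rw [← hμ τ]
  rw [integral_map (measurable_permute τ).aemeasurable
    (f := fun v => φ (firstCoords k N v)) (hφ.comp hm).aestronglyMeasurable]
  congr 1
  ext v
  congr 1
  ext i
  rw [firstCoords, dif_pos (i.2.trans_le hk), ← hτ i]
  rfl

theorem measurable_prod_ofReal_coord {g : ℝ → ℝ} (hg : Measurable g) (N : ℕ) :
    Measurable fun v : KacSphere N => ∏ j, ENNReal.ofReal (g (v.1 j)) := by fun_prop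

theorem lintegral_condTensor {g : ℝ → ℝ} (hg : Measurable g) {N : ℕ}
    {F : KacSphere N → ℝ≥0∞} (hF : Measurable F) :
    ∫⁻ v, F v ∂condTensor g N =
      (partitionFn g N)⁻¹ * ∫⁻ v, (∏ j, ENNReal.ofReal (g (v.1 j))) * F v ∂uniformSphere N := by
  have hm := measurable_prod_ofReal_coord hg N
  simp only [condTensor, div_eq_mul_inv]
  rw [lintegral_withDensity_eq_lintegral_mul _ (hm.mul_const _) hF,
    ← lintegral_const_mul _ (f := fun v : KacSphere N =>
      (∏ j, ENNReal.ofReal (g (v.1 j))) * F v) (hm.mul hF)]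
  refine lintegral_congr fun v => ?_
  simp only [Pi.mul_apply]
  ring

theorem isProbabilityMeasure_condTensor {g : ℝ → ℝ} (hg : Measurable g) {N : ℕ}
    (h0 : partitionFn g N ≠ 0) (ht : partitionFn g N ≠ ∞) :
    IsProbabilityMeasure (condTensor g N) := by
  refine ⟨?_⟩
  have := lintegral_condTensor hg (N := N) (F := fun _ => 1) measurable_const
  simp only [lintegral_const, one_mul, mul_one] at this
  rw [this]
  exact ENNReal.inv_mul_cancel h0 ht

/-- Exponential moments of block sums under the conditioned tensor product are, up to a
subexponential factor, at most those of independent blocks. -/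
theorem exists_eventually_lintegral_exp_condTensor_le {g : ℝ → ℝ} (hg : Measurable g)
    [hν : IsProbabilityMeasure (volume.withDensity fun v => ENNReal.ofReal (g v))]
    (h4 : MemLp (fun v => v ^ 2) 2 (volume.withDensity fun v => ENNReal.ofReal (g v)))
    (h1 : ∫ v, v ^ 2 ∂(volume.withDensity fun v => ENNReal.ofReal (g v)) = 1)
    {d : ℕ} (hd : d ≠ 0) (hgd : ∫⁻ t, ENNReal.ofReal (g t) ^ (1 + 2 / (d : ℝ)) < ∞)
    {ε : ℝ} (hε : 0 < ε) :
    ∀ᶠ N : ℕ in atTop, IsProbabilityMeasure (condTensor g (N + (d + 2))) ∧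
      ∀ R : (Fin N → ℝ) → ℝ≥0∞, Measurable R →
        ∫⁻ v, R (fun i => v.1 (Fin.castAdd (d + 2) i)) ∂condTensor g (N + (d + 2)) ≤
          ENNReal.ofReal (Real.exp (ε * N)) *
            ∫⁻ y, R y ∂(Measure.pi fun _ => volume.withDensity fun v => ENNReal.ofReal (g v)) := by
  set G : ℝ → ℝ≥0∞ := fun v => ENNReal.ofReal (g v) with hGdef
  have hG : Measurable G := hg.ennreal_ofReal
  set C : ℝ≥0∞ := (d + 2 : ℕ) * ((d + 1 : ℕ) * (ENNReal.ofReal (2 * Real.pi) *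
    (∫⁻ t, G t ^ (1 + 2 / (d : ℝ))) ^ d)) with hC
  have hCt : C ≠ ∞ := ENNReal.mul_ne_top (ENNReal.natCast_ne_top _)
    (ENNReal.mul_ne_top (ENNReal.natCast_ne_top _)
      (ENNReal.mul_ne_top ENNReal.ofReal_ne_top (ENNReal.pow_ne_top hgd.ne)))
  have hup := fun (N : ℕ) (R : (Fin N → ℝ) → ℝ≥0∞) (hR : Measurable R) =>
    lintegral_uniformSphere_prod_mul_le hG hd N hR
  -- Half of `ε` pays for the lower bound on the partition function in dimension `N + d + 2`; the
  -- other half absorbs the constant `C`, which does not depend on `N`.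
  have hlow := (tendsto_add_atTop_nat (d + 1)).eventually
    (eventually_exp_le_sumDensity hG h4 h1 (half_pos hε))
  have hCle : ∀ᶠ N : ℕ in atTop, C ≤ ENNReal.ofReal (Real.exp (ε / 2 * N - ε / 2 * (d + 1))) := by
    have ht : Tendsto (fun N : ℕ => Real.exp (ε / 2 * N - ε / 2 * (d + 1))) atTop atTop :=
      Real.tendsto_exp_atTop.comp (tendsto_atTop_add_const_right _ _
        (tendsto_natCast_atTop_atTop.const_mul_atTop (half_pos hε)))
    filter_upwards [ht.eventually_ge_atTop C.toReal] with N hN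
    rw [← ENNReal.ofReal_toReal hCt]
    exact ENNReal.ofReal_le_ofReal hN
  filter_upwards [hlow, hCle] with N hN hCN
  have hZ : partitionFn g (N + (d + 2)) =
      sheetConst (N + (d + 1)) * sumDensity G (N + (d + 1)) (N + (d + 1) + 1 : ℕ) :=
    partitionFn_eq hg (N + (d + 1))
  set κ := sheetConst (N + (d + 1))
  have hκ0 : κ ≠ 0 := sheetConst_ne_zero _
  have hκt : κ ≠ ∞ := sheetConst_ne_top _
  set x : ℝ≥0∞ := ENNReal.ofReal (Real.exp (-(ε / 2 * (N + (d + 1) : ℕ)))) with hx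
  have hx0 : x ≠ 0 := by simpa [hx] using Real.exp_pos _
  have hZle : κ * x ≤ partitionFn g (N + (d + 2)) := by
    rw [hZ]
    gcongr
  have hZ0 : partitionFn g (N + (d + 2)) ≠ 0 :=
    ((pos_iff_ne_zero.2 (mul_ne_zero hκ0 hx0)).trans_le hZle).ne'
  have hZt : partitionFn g (N + (d + 2)) ≠ ∞ := by
    have := hup N (fun _ => 1) measurable_const
    simp only [mul_one, lintegral_const, measure_univ] at this
    exact ne_top_of_le_ne_top (ENNReal.mul_ne_top hκt hCt) this
  refine ⟨isProbabilityMeasure_condTensor hg hZ0 hZt, fun R hR => ?_⟩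
  set I := ∫⁻ y, R y ∂(Measure.pi fun _ => volume.withDensity G)
  have hm : Measurable fun v : KacSphere (N + (d + 2)) =>
      R (fun i => v.1 (Fin.castAdd (d + 2) i)) := hR.comp (by fun_prop)
  rw [lintegral_condTensor hg hm]
  have hCx : x⁻¹ * C ≤ ENNReal.ofReal (Real.exp (ε * N)) := by
    rw [mul_comm, ← div_eq_mul_inv, ENNReal.div_le_iff hx0 ENNReal.ofReal_ne_top]
    refine hCN.trans (le_of_eq ?_)
    rw [hx, ← ENNReal.ofReal_mul (Real.exp_pos _).le, ← Real.exp_add]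
    congr 2
    push_cast
    ring
  calc _ ≤ (κ * x)⁻¹ * (κ * (C * I)) := by
        gcongr
        exact hup N R hR
    _ = κ⁻¹ * κ * (x⁻¹ * C * I) := by
        rw [ENNReal.mul_inv (Or.inl hκ0) (Or.inl hκt)]
        ring
    _ = x⁻¹ * C * I := by rw [ENNReal.inv_mul_cancel hκ0 hκt, one_mul]
    _ ≤ _ := by gcongr

/-! ### Convergence of the marginals. -/

/-- The entropy inequality applied to sums over blocks of coordinates. -/
theorem mul_integral_marginal_sub_le {m : Measure ℝ} [IsProbabilityMeasure m] {N s : ℕ}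
    {π : Measure (KacSphere (N + s))} [IsProbabilityMeasure π] {x y : ℝ} (hy : 0 ≤ y)
    (hπ : ∀ R : (Fin N → ℝ) → ℝ≥0∞, Measurable R →
      ∫⁻ v, R (fun i => v.1 (Fin.castAdd s i)) ∂π ≤
        ENNReal.ofReal (Real.exp x) * ∫⁻ z, R z ∂(Measure.pi fun _ => m))
    {μ : ProbabilityMeasure (KacSphere (N + s))}
    (hμ : IsSymmetric (μ : Measure (KacSphere (N + s))))
    (hkl : InformationTheory.klDiv (μ : Measure (KacSphere (N + s))) π ≤ ENNReal.ofReal y)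
    {k L : ℕ} (hkN : k ≤ N) (hL : L * k ≤ N) {φ : (Fin k → ℝ) → ℝ} (hφ : Measurable φ) {B : ℝ}
    (hB : ∀ x, |φ x| ≤ B) {t : ℝ} (ht : 0 < t) :
    t * (L * (∫ x, φ x ∂(marginal k μ : Measure (Fin k → ℝ)) -
      ∫ x, φ x ∂(Measure.pi fun _ => m))) ≤ y + (x + L * (B ^ 2 * t ^ 2 / 2)) := by
  have hB0 : 0 ≤ B := (abs_nonneg _).trans (hB 0)
  set a := ∫ x, φ x ∂(Measure.pi fun _ : Fin k => m) with ha
  obtain ⟨e, hei⟩ : ∃ e : Fin L × Fin k → Fin N, Function.Injective e :=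
    ⟨fun p => Fin.castLE hL (finProdFinEquiv p),
      (Fin.castLE_injective hL).comp finProdFinEquiv.injective⟩
  set R : (Fin N → ℝ) → ℝ := fun z => t * ∑ b, (φ (fun i => z (e (b, i))) - a) with hR
  have hφb : ∀ b : Fin L, Measurable fun z : Fin N → ℝ => φ (fun i => z (e (b, i))) := fun b =>
    hφ.comp (measurable_pi_lambda _ fun i => measurable_pi_apply _)
  have hRm : Measurable R :=
    (Finset.measurable_sum _ fun b _ => (hφb b).sub_const a).const_mul t
  have hab : |a| ≤ B := by
    have := norm_integral_le_of_norm_le_const (μ := Measure.pi fun _ : Fin k => m)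
      (ae_of_all _ fun x => (Real.norm_eq_abs (φ x)).trans_le (hB x))
    simpa using this
  have hRB : ∀ z, |R z| ≤ t * (L * (2 * B)) := by
    intro z
    rw [hR, abs_mul, abs_of_pos ht]
    gcongr
    refine (Finset.abs_sum_le_sum_abs _ _).trans ?_
    calc _ ≤ ∑ b : Fin L, 2 * B := by
          refine Finset.sum_le_sum fun b _ => (abs_sub _ _).trans ?_
          linarith [hB fun i => z (e (b, i))]
      _ = _ := by simp
  have hhead : Measurable fun (v : KacSphere (N + s)) (i : Fin N) => v.1 (Fin.castAdd s i) := by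
    fun_prop
  set F : KacSphere (N + s) → ℝ := fun v => R fun i => v.1 (Fin.castAdd s i) with hF
  have hFm : Measurable F := hRm.comp hhead
  have hFB : ∀ v, |F v| ≤ t * (L * (2 * B)) := fun v => hRB fun i => v.1 (Fin.castAdd s i)
  have hdv := integral_le_klDiv_add_log_integral_exp (ne_top_of_le_ne_top ENNReal.ofReal_ne_top hkl)
    hFm hFB
  have hsum : ∫ v, F v ∂(μ : Measure (KacSphere (N + s))) =
      t * (L * (∫ x, φ x ∂(marginal k μ : Measure (Fin k → ℝ)) - a)) := by
    have hterm : ∀ b : Fin L, ∫ v : KacSphere (N + s),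
        φ (fun i => v.1 (Fin.castAdd s (e (b, i)))) ∂(μ : Measure (KacSphere (N + s))) =
          ∫ x, φ x ∂(marginal k μ : Measure (Fin k → ℝ)) := fun b =>
      (integral_marginal_eq hμ (hkN.trans (Nat.le_add_right N s))
        (f := fun i => Fin.castAdd s (e (b, i)))
        (fun i j hij => (Prod.ext_iff.1 (hei (Fin.castAdd_injective _ _ hij))).2) hφ).symm
    have hint : ∀ b : Fin L, Integrable (fun v : KacSphere (N + s) =>
        φ (fun i => v.1 (Fin.castAdd s (e (b, i))))) (μ : Measure (KacSphere (N + s))) := fun b =>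
      Integrable.of_bound ((hφb b).comp hhead).aestronglyMeasurable B (ae_of_all _ fun v => hB _)
    have hint' : ∀ b : Fin L, Integrable (fun v : KacSphere (N + s) =>
        φ (fun i => v.1 (Fin.castAdd s (e (b, i)))) - a) (μ : Measure (KacSphere (N + s))) :=
      fun b => (hint b).sub (integrable_const a)
    simp only [hF, hR]
    rw [integral_const_mul, integral_finsetSum _ fun b _ => hint' b]
    simp_rw [integral_sub (hint _) (integrable_const a), hterm]
    simp [mul_sub]
  have hexpF : ∫ v, Real.exp (F v) ∂π ≤ Real.exp (x + L * (B ^ 2 * t ^ 2 / 2)) := by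
    rw [integral_eq_lintegral_of_nonneg_ae (ae_of_all _ fun _ => (Real.exp_pos _).le)
      hFm.exp.aestronglyMeasurable]
    refine ENNReal.toReal_le_of_le_ofReal (Real.exp_pos _).le ?_
    refine (hπ (fun z => ENNReal.ofReal (Real.exp (R z))) hRm.exp.ennreal_ofReal).trans ?_
    rw [Real.exp_add, ENNReal.ofReal_mul (Real.exp_pos _).le]
    gcongr
    exact lintegral_exp_blocks_le hei hφ hB t
  have hlog : Real.log (∫ v, Real.exp (F v) ∂π) ≤ x + L * (B ^ 2 * t ^ 2 / 2) := by
    have hpos : 0 < ∫ v, Real.exp (F v) ∂π := by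
      refine integral_exp_pos (Integrable.of_bound hFm.exp.aestronglyMeasurable
        (Real.exp (t * (L * (2 * B)))) (ae_of_all _ fun v => ?_))
      rw [Real.norm_eq_abs, Real.abs_exp]
      exact Real.exp_le_exp.2 ((le_abs_self _).trans (hFB v))
    rw [Real.log_le_iff_le_exp hpos]
    exact hexpF
  have hklr := ENNReal.toReal_le_of_le_ofReal hy hkl
  rw [hsum] at hdv
  linarith

/-- One-sided convergence of the integrals of bounded functions against the marginals. -/
theorem eventually_integral_marginal_le {g : ℝ → ℝ} (hg : Measurable g)
    [hν : IsProbabilityMeasure (volume.withDensity fun v => ENNReal.ofReal (g v))]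
    (h4 : MemLp (fun v => v ^ 2) 2 (volume.withDensity fun v => ENNReal.ofReal (g v)))
    (h1 : ∫ v, v ^ 2 ∂(volume.withDensity fun v => ENNReal.ofReal (g v)) = 1)
    {d : ℕ} (hd : d ≠ 0) (hgd : ∫⁻ t, ENNReal.ofReal (g t) ^ (1 + 2 / (d : ℝ)) < ∞)
    {μ : ∀ N : ℕ, ProbabilityMeasure (KacSphere N)}
    (hμ_symm : ∀ N, 1 ≤ N → IsSymmetric (μ N : Measure (KacSphere N)))
    (hμ_entropy : Tendsto (fun N : ℕ => InformationTheory.klDiv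
      (μ N : Measure (KacSphere N)) (condTensor g N) / (N : ℝ≥0∞)) atTop (𝓝 0))
    {k : ℕ} (hk : 1 ≤ k) {φ : (Fin k → ℝ) → ℝ} (hφ : Measurable φ) {B : ℝ}
    (hB : ∀ x, |φ x| ≤ B) {δ : ℝ} (hδ : 0 < δ) :
    ∀ᶠ N in atTop, ∫ x, φ x ∂(marginal k (μ N) : Measure (Fin k → ℝ)) ≤
      ∫ x, φ x ∂(Measure.pi fun _ => volume.withDensity fun v => ENNReal.ofReal (g v)) + δ := by
  have hB0 : 0 ≤ B := (abs_nonneg _).trans (hB 0)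
  have hk0 : (0 : ℝ) < k := by exact_mod_cast hk
  -- Small enough for Hoeffding's term to take at most a quarter of `t δ L`; the `+ 1` covers `B =
  -- 0`.
  set t := δ / (2 * (B ^ 2 + 1)) with ht
  have ht0 : 0 < t := by positivity
  have htB : B ^ 2 * t ≤ δ / 2 := by
    rw [ht, mul_div_assoc', div_le_div_iff₀ (by positivity) two_pos]
    nlinarith [sq_nonneg B]
  -- As the dimension is at most `2 k L`, the entropy and the comparison factor each take at most a
  -- quarter of `t δ L`.
  set ε := t * δ / (8 * k) with hε
  have hε0 : 0 < ε := by positivity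
  have hεk : ε * (8 * k) = t * δ := div_mul_cancel₀ _ (by positivity)
  have hent : ∀ᶠ N : ℕ in atTop, InformationTheory.klDiv (μ N : Measure (KacSphere N))
      (condTensor g N) ≤ ENNReal.ofReal (ε * N) := by
    filter_upwards [hμ_entropy.eventually_lt_const (ENNReal.ofReal_pos.2 hε0),
      eventually_ge_atTop 1] with N hN hN1
    have hN0 : (N : ℝ≥0∞) ≠ 0 := by exact_mod_cast (Nat.pos_iff_ne_zero.1 hN1)
    rw [ENNReal.div_lt_iff (Or.inl hN0) (Or.inl (ENNReal.natCast_ne_top N))] at hN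
    refine hN.le.trans (le_of_eq ?_)
    rw [ENNReal.ofReal_mul hε0.le, ENNReal.ofReal_natCast]
  rw [← map_add_atTop_eq_nat (d + 2), eventually_map]
  filter_upwards [exists_eventually_lintegral_exp_condTensor_le hg h4 h1 hd hgd hε0,
    (tendsto_add_atTop_nat (d + 2)).eventually hent, eventually_ge_atTop (2 * k),
    eventually_ge_atTop (4 * k + 2 * d + 4)] with N ⟨hprob, hexp⟩ hkl hN1 hN2
  set M := N + (d + 2) with hM
  set L := N / k with hL
  set ν := volume.withDensity fun v => ENNReal.ofReal (g v)
  set a := ∫ x, φ x ∂(Measure.pi fun _ : Fin k => ν) with ha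
  have hLk : L * k ≤ N := Nat.div_mul_le_self N k
  have hLN : (M : ℝ) ≤ 2 * k * L := by
    have h2 : N < (L + 1) * k := by
      rw [mul_comm]
      exact Nat.lt_mul_div_succ N hk
    have h3 : M ≤ 2 * k * L := by
      rw [hM]
      nlinarith
    exact_mod_cast h3
  have hdv := mul_integral_marginal_sub_le (by positivity) hexp (hμ_symm M (by omega)) hkl
    (by omega) hLk hφ hB ht0
  have hNM : (N : ℝ) ≤ M := by exact_mod_cast (by omega : N ≤ M)
  have hL0 : (0 : ℝ) < L := by exact_mod_cast Nat.div_pos (by omega) hk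
  set D := ∫ x, φ x ∂(marginal k (μ M) : Measure (Fin k → ℝ)) - a with hD
  have hfin : t * (L * D) ≤ t * (L * δ) := by
    have e1 : ε * M ≤ t * δ * L / 4 := by
      calc ε * M ≤ ε * (2 * k * L) := by gcongr
        _ = ε * (8 * k) * L / 4 := by ring
        _ = _ := by rw [hεk]
    have e2 : ε * N ≤ ε * M := by gcongr
    have e3 : L * (B ^ 2 * t ^ 2 / 2) ≤ t * δ * L / 4 := by
      calc L * (B ^ 2 * t ^ 2 / 2) = L * (B ^ 2 * t) * t / 2 := by ring
        _ ≤ L * (δ / 2) * t / 2 := by gcongr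
        _ = _ := by ring
    have e4 : 0 ≤ t * δ * L := by positivity
    linarith
  have hDδ : D ≤ δ := le_of_mul_le_mul_left (le_of_mul_le_mul_left hfin ht0) hL0
  linarith

end KacChaos

theorem mainTheorem7
    (g : ℝ → ℝ) (hg_meas : Measurable g) (hg_nonneg : ∀ v, 0 ≤ g v)
    (ν : ProbabilityMeasure ℝ)
    (hν : (ν : Measure ℝ) = volume.withDensity (fun v => ENNReal.ofReal (g v)))
    (h2 : ∫ v, g v * v ^ 2 = 1)
    (h4 : Integrable (fun v => g v * v ^ 4))
    (p : ENNReal) (hp : 1 < p) (hgp : MemLp g p)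
    (μ : ∀ N : ℕ, ProbabilityMeasure (KacChaos.KacSphere N))
    (hμ_symm : ∀ N, 1 ≤ N → KacChaos.IsSymmetric (μ N : Measure (KacChaos.KacSphere N)))
    (hμ_entropy : Tendsto
      (fun N : ℕ => InformationTheory.klDiv
        (μ N : Measure (KacChaos.KacSphere N)) (KacChaos.condTensor g N) / (N : ENNReal))
      atTop (𝓝 0)) :
    KacChaos.IsChaotic ν μ ∧
      ∀ k : ℕ, 1 ≤ k →
        Tendsto (fun N => KacChaos.marginal k (μ N)) atTop (𝓝 (KacChaos.tensorPower ν k)) := by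
  have hG : Measurable fun v => ENNReal.ofReal (g v) := hg_meas.ennreal_ofReal
  have hprob : IsProbabilityMeasure (volume.withDensity fun v => ENNReal.ofReal (g v)) :=
    hν ▸ inferInstance
  have hfin : ∀ᵐ v, ENNReal.ofReal (g v) < ⊤ := ae_of_all _ fun _ => ENNReal.ofReal_lt_top
  have hsmul : ∀ n : ℕ, (fun v => (ENNReal.ofReal (g v)).toReal • v ^ n) = fun v => g v * v ^ n :=
    fun n => funext fun v => by rw [ENNReal.toReal_ofReal (hg_nonneg v), smul_eq_mul]
  have hgi : Integrable g := by
    refine ⟨hg_meas.aestronglyMeasurable, ?_⟩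
    have h := hprob.measure_univ
    rw [withDensity_apply _ .univ, setLIntegral_univ] at h
    rw [hasFiniteIntegral_iff_ofReal (ae_of_all _ hg_nonneg), h]
    exact ENNReal.one_lt_top
  have hmean : ∫ v, v ^ 2 ∂(volume.withDensity fun v => ENNReal.ofReal (g v)) = 1 := by
    rw [integral_withDensity_eq_integral_toReal_smul hG hfin, hsmul, h2]
  have hsq : MemLp (fun v => v ^ 2) 2 (volume.withDensity fun v => ENNReal.ofReal (g v)) := by
    rw [memLp_two_iff_integrable_sq (by fun_prop),
      integrable_withDensity_iff_integrable_smul' hG hfin]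
    simpa only [← pow_mul, hsmul] using h4
  obtain ⟨d, hd, hgd⟩ := KacChaos.exists_lintegral_ofReal_rpow_lt_top hg_meas hgi hp hgp
  have hmain : ∀ k : ℕ, 1 ≤ k →
      Tendsto (fun N => KacChaos.marginal k (μ N)) atTop (𝓝 (KacChaos.tensorPower ν k)) := by
    intro k hk
    rw [ProbabilityMeasure.tendsto_iff_forall_integral_tendsto]
    intro φ
    have hφ : Measurable φ := φ.continuous.measurable
    have hcoe : (KacChaos.tensorPower ν k : Measure (Fin k → ℝ)) =
        Measure.pi fun _ => volume.withDensity fun v => ENNReal.ofReal (g v) := by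
      rw [← hν]
      rfl
    -- The one-sided bound is kept general in `ψ` so that it serves for both `φ` and `-φ`.
    have hle := fun (ψ : (Fin k → ℝ) → ℝ) (hψ : Measurable ψ) (hB : ∀ x, |ψ x| ≤ ‖φ‖) (δ : ℝ)
        (hδ : 0 < δ) => KacChaos.eventually_integral_marginal_le hg_meas hsq hmean hd hgd hμ_symm
      hμ_entropy hk hψ hB hδ
    rw [hcoe, Metric.tendsto_nhds]
    intro δ hδ
    filter_upwards [hle φ hφ φ.norm_coe_le_norm (δ / 2) (half_pos hδ),
      hle (fun x => -φ x) hφ.neg (fun x => by rw [abs_neg]; exact φ.norm_coe_le_norm x)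
        (δ / 2) (half_pos hδ)] with N h1 h2
    rw [integral_neg, integral_neg] at h2
    rw [Real.dist_eq]
    exact abs_lt.2 ⟨by linarith, by linarith⟩
  exact ⟨⟨hμ_symm, hmain⟩, hmain⟩
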